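/- Let $X$ be a compact connected Riemann surface of genus $g$ (the dimension of its space of holomorphic one-forms), $p_\infty\in X$, and let $L=\mathcal O(D)$ be a flat line bundle on $X$, where $D$ is a divisor of degree $0$. (For a zero $e$ of Riemann's theta function and Riemann's constant $\delta$, the bundle $L_{e+\delta}$ is the case $D=q_1+\cdots+q_{g-1}-(g-1)p_\infty$ with $q_i\in X$.) An integer $b\ge 0$ is a *non-gap* of $L$ if there is a meromorphic section of $L$, holomorphic on $X\setminus\{p_\infty\}$, with a pole of order exactly $b$ at $p_\infty$; otherwise it is a *gap*. Let $b_1<\cdots<b_g$ be the gaps and $b_1^*<b_2^*<\cdots$ the non-gaps of $L$. Put $\lambda=(b_g,\dots,b_1)-(g-1,\dots,1,0)$, $m_k=h^0(D+(g-1-k)p_\infty)$ and $$A_k=(b_{g-k},b_{g-k-1},\dots,b_{g-k-m_k+1})-(b_1^*,\dots,b_{m_k}^*),$$ and let $c_k=\pm1$ be the sign of the permutation of $\{0,1,\dots,g-k-1\}$ $$\begin{pmatrix} b_1^*&\cdots&b_{m_k}^*&b_{g-k-m_k}&\cdots&b_1\\ g-k-1&\cdots&\cdot&\cdot&\cdots&0\end{pmatrix}.$$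 For a partition $\mu=(\mu_1,\dots,\mu_l)$, identified with $(\mu_1,\dots,\mu_l,0,\dots,0)$, let $|\mu|=\mu_1+\cdots+\mu_l$ and $s_\mu(t)=\det(p_{\mu_i-i+j}(t))_{1\le i,j\le l}$, where $\exp\bigl(\sum_{n\ge1}t_nz^n\bigr)=\sum_{n\ge0}p_n(t)z^n$ and $p_n=0$ for $n<0$; $s_\mu=1$ for the empty partition. Let $[x]=(x,x^2/2,x^3/3,\dots)$ and, for a sequence $I=(i_1,\dots,i_m)$ of positive integers, $\partial_{t,I}=\partial_{t_{i_1}}\cdots\partial_{t_{i_m}}$. 1. Let $0\le k\le g-1$ with $m_k>0$, and let $\mu$ be a partition with $\mu_i=\lambda_i$ for all $i\ge k+1$. Then, for all $x_1,\dots,x_k\in\mathbb C$, $$\partial_{t,A_k}s_\mu\Bigl(\sum_{i=1}^k[x_i]\Bigr)=c_k\,s_{(\mu_1,\dots,\mu_k)}\Bigl(\sum_{i=1}^k[x_i]\Bigr).$$ 2. (i) For every partition $\mu$ and every $I=(i_1,\dots,i_m)$ with $m\ge1$ and $\sum_j i_j\ne|\mu|$, one has $\partial_{t,I}s_\mu(0)=0$.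 (ii) If $\mu$ is a partition with $\mu_i\ge\lambda_i$ for all $i$, then $\partial_{t,I}s_\mu(0)=0$ for every $I=(i_1,\dots,i_m)$ with $0\le m<m_0$. (iii) $\partial_{t,A_0}s_\lambda(0)=c_0$. -/

import Mathlib

open scoped Manifold ContDiff Topology

noncomputable section

namespace RiemannSchur

section Surface

variable (X : Type*) [TopologicalSpace X] [ChartedSpace ℂ X]

/-- The space of holomorphic one-forms: analytic sections of the holomorphic cotangent bundle. -/
abbrev HolOneForm [IsManifold 𝓘(ℂ) ω X] : Type _ :=
  Cₛ^ω⟮𝓘(ℂ); ℂ →L[ℂ] ℂ, fun x : X => TangentSpace 𝓘(ℂ) x →L[ℂ] Bundle.Trivial X ℂ x⟯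

/-- The genus: the dimension of the space of holomorphic one-forms. -/
def genus [IsManifold 𝓘(ℂ) ω X] : ℕ := Module.finrank ℂ (HolOneForm X)

variable {X}

/-- `f` is meromorphic at `x` (read in the chart around `x`; the values of `f` at poles are
irrelevant). -/
def MeroAt (f : X → ℂ) (x : X) : Prop :=
  MeromorphicAt (f ∘ (chartAt ℂ x).symm) (chartAt ℂ x x)

/-- The order of vanishing of `f` at `x`: negative at poles, `⊤` if `f` vanishes identically
on a punctured neighbourhood of `x`. -/
def ordAt (f : X → ℂ) (x : X) : WithTop ℤ :=
  meromorphicOrderAt (f ∘ (chartAt ℂ x).symm) (chartAt ℂ x x)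

/-- The degree of a divisor. -/
def divDegree (D : X →₀ ℤ) : ℤ := D.sum fun _ n => n

/-- The functions that are zero as meromorphic functions, i.e. zero off a discrete set. -/
def nullFun (X : Type*) [TopologicalSpace X] : Submodule ℂ (X → ℂ) where
  carrier := {f | ∀ x, ∀ᶠ y in 𝓝[≠] x, f y = 0}
  zero_mem' := by
    intro x
    simp
  add_mem' := by
    intro f g hf hg x
    filter_upwards [hf x, hg x] with y h1 h2
    simp [h1, h2]
  smul_mem' := by
    intro c f hf x
    filter_upwards [hf x] with y h1
    simp [h1]

/-- The meromorphic functions `f` with `(f) + D ≥ 0`, i.e. the global holomorphic sections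
of the line bundle `O(D)`. -/
def sectionSpace (D : X →₀ ℤ) : Submodule ℂ (X → ℂ) where
  carrier := {f | ∀ x, MeroAt f x ∧ ((-(D x) : ℤ) : WithTop ℤ) ≤ ordAt f x}
  zero_mem' := by
    intro x
    have h0 : ((0 : X → ℂ) ∘ (chartAt ℂ x).symm) = fun _ => (0 : ℂ) := rfl
    refine ⟨?_, ?_⟩
    · unfold MeroAt
      rw [h0]
      exact MeromorphicAt.const 0 _
    · have : ordAt (0 : X → ℂ) x = ⊤ := by
        unfold ordAt
        rw [h0, meromorphicOrderAt_eq_top_iff]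
        simp
      rw [this]
      exact le_top
  add_mem' := by
    intro f g hf hg x
    refine ⟨(hf x).1.add (hg x).1, ?_⟩
    exact le_trans (le_min (hf x).2 (hg x).2) (meromorphicOrderAt_add (hf x).1 (hg x).1)
  smul_mem' := by
    intro c f hf x
    have hc : MeromorphicAt (fun _ : ℂ => c) (chartAt ℂ x x) := MeromorphicAt.const c _
    refine ⟨hc.smul (hf x).1, ?_⟩
    have h1 : ordAt (c • f) x
        = meromorphicOrderAt (fun _ : ℂ => c) (chartAt ℂ x x) + ordAt f x :=
      meromorphicOrderAt_smul hc (hf x).1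
    have h2 : 0 ≤ meromorphicOrderAt (fun _ : ℂ => c) (chartAt ℂ x x) := by
      classical
      rw [meromorphicOrderAt_const]
      split_ifs <;> simp
    rw [h1]
    exact le_trans (hf x).2 (le_add_of_nonneg_left h2)

/-- `h⁰(D)`: the dimension of the space of meromorphic functions `f` with `(f) + D ≥ 0`, where
two functions that agree off a discrete set are the same meromorphic function. -/
def h0 (D : X →₀ ℤ) : ℕ :=
  Module.finrank ℂ ((sectionSpace D).map (nullFun X).mkQ)

/-- `b` is a non-gap of `O(D)` at `p`: there is a meromorphic section of `O(D)`, holomorphic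
off `p`, with a pole of order exactly `b` at `p`. A meromorphic section of `O(D)` is a meromorphic
function `f`, and its order at `x` as a section is `ord_x f + D x`. -/
def IsNonGap (D : X →₀ ℤ) (p : X) (b : ℕ) : Prop :=
  ∃ f : X → ℂ, (∀ x, MeroAt f x) ∧
    (∀ x, x ≠ p → 0 ≤ ordAt f x + ((D x : ℤ) : WithTop ℤ)) ∧
    ordAt f p + ((D p : ℤ) : WithTop ℤ) = ((-(b : ℤ) : ℤ) : WithTop ℤ)

/-- `b` is a gap of `O(D)` at `p`. -/
def IsGap (D : X →₀ ℤ) (p : X) (b : ℕ) : Prop := ¬ IsNonGap D p b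

/-- `gap D p i` is the gap `b_{i+1}`, where `b_1 < b_2 < ⋯` are the gaps of `O(D)` at `p`. -/
def gap (D : X →₀ ℤ) (p : X) (i : ℕ) : ℕ := Nat.nth (IsGap D p) i

/-- `nonGap D p i` is the non-gap `b*_{i+1}`, where `b*_1 < b*_2 < ⋯` are the non-gaps
of `O(D)` at `p`. -/
def nonGap (D : X →₀ ℤ) (p : X) (i : ℕ) : ℕ := Nat.nth (IsNonGap D p) i

variable [IsManifold 𝓘(ℂ) ω X]

/-- The partition `λ = (b_g, …, b_1) - (g-1, …, 0)`, followed by zeros: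
`gapPartition D p i` is `λ_{i+1}`. -/
def gapPartition (D : X →₀ ℤ) (p : X) (i : ℕ) : ℕ :=
  if i < genus X then gap D p (genus X - 1 - i) - (genus X - 1 - i) else 0

/-- `m_k = h⁰(D + (g-1-k) p)`; for `D = q_1 + ⋯ + q_{g-1} - (g-1) p` this is
`h⁰(q_1 + ⋯ + q_{g-1} - k p)`. -/
def mult (D : X →₀ ℤ) (p : X) (k : ℕ) : ℕ :=
  h0 (D + Finsupp.single p ((genus X : ℤ) - 1 - (k : ℤ)))

/-- The a-sequence
`A_k = (b_{g-k}, b_{g-k-1}, …, b_{g-k-m_k+1}) - (b*_1, …, b*_{m_k})`. -/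
def aSeq (D : X →₀ ℤ) (p : X) (k : ℕ) : List ℕ :=
  (List.range (mult D p k)).map fun i => gap D p (genus X - k - 1 - i) - nonGap D p i

/-- The sequence `(b*_1, …, b*_{m_k}, b_{g-k-m_k}, …, b_1)`, indexed from `0` to `g-k-1`. -/
def topRow (D : X →₀ ℤ) (p : X) (k : ℕ) (i : ℕ) : ℕ :=
  if i < mult D p k then nonGap D p i else gap D p (genus X - k - 1 - i)

/-- `σ` is the permutation of `{0, …, g-k-1}` given in two-line notation by the rows
`(b*_1, …, b*_{m_k}, b_{g-k-m_k}, …, b_1)` and `(g-k-1, …, 1, 0)`: it sends each entry of the upper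
row to the entry below it. -/
def IsGapPerm (D : X →₀ ℤ) (p : X) (k : ℕ) (σ : Equiv.Perm (Fin (genus X - k))) : Prop :=
  ∀ i : Fin (genus X - k), ((σ.symm (Fin.rev i) : Fin (genus X - k)) : ℕ) = topRow D p k i

end Surface

section Schur

/-- `μ` is a partition `(μ_1, …, μ_l)` with at most `l` non-zero parts, followed by zeros;
`μ i` is `μ_{i+1}`. -/
def IsPartition (l : ℕ) (μ : ℕ → ℕ) : Prop :=
  Antitone μ ∧ ∀ i, l ≤ i → μ i = 0

/-- The series `t_1 z + t_2 z² + ⋯` in `z` over the polynomial ring in the variables `t_n`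
(the variable with index `0` is not used). -/
def tSeries : PowerSeries (MvPolynomial ℕ ℂ) :=
  PowerSeries.mk fun n => if n = 0 then 0 else MvPolynomial.X n

/-- `p_n(t)`, the coefficient of `z^n` in `exp(t_1 z + t_2 z² + ⋯)`, and `0` for `n < 0`. -/
def schurP (n : ℤ) : MvPolynomial ℕ ℂ :=
  if 0 ≤ n then
    PowerSeries.coeff n.toNat ((PowerSeries.exp (MvPolynomial ℕ ℂ)).subst tSeries)
  else 0

/-- The Schur function `s_{(μ_1, …, μ_l)}(t) = det (p_{μ_i - i + j}(t))`. -/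
def schur (l : ℕ) (μ : ℕ → ℕ) : MvPolynomial ℕ ℂ :=
  Matrix.det (Matrix.of fun i j : Fin l => schurP ((μ i : ℤ) - (i : ℤ) + (j : ℤ)))

/-- `∂_{t,I} = ∂_{t_{i_1}} ⋯ ∂_{t_{i_m}}` for `I = (i_1, …, i_m)`. -/
def partialT (I : List ℕ) (F : MvPolynomial ℕ ℂ) : MvPolynomial ℕ ℂ :=
  I.foldr (fun i G => MvPolynomial.pderiv i G) F

/-- The point `∑_i [x_i]`, where `[x] = (x, x²/2, x³/3, …)`. -/
def bracketSum {k : ℕ} (x : Fin k → ℂ) (n : ℕ) : ℂ := ∑ i, x i ^ n / (n : ℂ)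

end Schur

end RiemannSchur

end

/-! The argument joins the combinatorics of determinants to a count of gaps.

Write a Schur function with `N` rows as `betaDet` of the strictly decreasing labels `β_r = μ_r + N -
1 - r`, with `r` counted from 0. As `∂p_q/∂t_a = p_{q-a}`, the operator `∂_{t_a}` is the sum over
the rows of lowering one label by `a` (`pderiv_betaDet`). At `[x_1] + ⋯ + [x_k]` the generating
series of the `p_q` is `1/∏(1 - x_i z)`. Hence for `N = k + n` column operations turn the last `n`
columns into indicators of the labels `n-1, …, 0` (`eval_betaDet`), and the value vanishes if more
than `k` labels are `≥ n`.

Take `n = g - k`. If `μ` agrees with `λ` beyond its first `k` parts, the last `n` labels are the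
gaps `b_n > ⋯ > b_1`, and exactly `m = m_k` of them are `≥ n`. So `k + m` labels are large, and each
of the `m` derivatives must push one of them below `n`. The last entry of `A_k` takes the smallest
large label to the largest missing value `b*_m`. Applied to a bigger label it either leaves that
label large or hits a value already taken, and two equal small labels stay equal to the end. One
term survives (`eval_partialT_aSeq`). Its matrix is block triangular, made of a permutation matrix
that gives `c_k` and the matrix of `s_{(μ_1,…,μ_k)}` (`eval_betaDet_perm`). The origin is the case
`k = 0`.

The geometry supplies two facts. First, `m_k` is the number of non-gaps below `g - k`
(`mult_eq_count`): `h⁰(D + (N-1)p)` is 0 for `N = 0`, because principal divisors have degree 0, and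
grows by one exactly at the non-gaps. Second, there are at least `g` gaps
(`exists_genus_le_count_gap`). This follows from the inequality `h⁰(E) + g ≤ deg E + 1 + dim {ω :
(ω) ≥ E}` for effective `E` (`h0_add_genus_le`), proved by adding one point at a time. That there
are no more than `g` gaps is never needed, so the existence half of Riemann–Roch is avoided.

Both facts rest on the residue theorem (`sum_residue_eq_zero`): for a partition of unity `ρ_i` that
is constant near the poles, the integrals of `∂̄ρ_i ∧ η` add up to 0 because `∑ ∂̄ρ_i = 0`, while
each is a fixed non-zero constant times a residue, or 0. -/

namespace RiemannSchur

noncomputable section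

/-! ### The polynomials `p_n`: derivatives, and values at sums of points. -/

section GeneratingSeries

open PowerSeries

/-- The generating series `exp(t_1 z + t_2 z² + ⋯)` of the polynomials `p_n(t)`. -/
def schurSeries : PowerSeries (MvPolynomial ℕ ℂ) :=
  (PowerSeries.exp (MvPolynomial ℕ ℂ)).subst tSeries

theorem hasSubst_tSeries : HasSubst tSeries :=
  HasSubst.of_constantCoeff_zero' (by simp [tSeries])

theorem derivative_schurSeries :
    derivative (MvPolynomial ℕ ℂ) schurSeries =
      schurSeries * derivative (MvPolynomial ℕ ℂ) tSeries := by
  rw [schurSeries, derivative_subst hasSubst_tSeries, derivative_exp]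

theorem constantCoeff_schurSeries : constantCoeff schurSeries = 1 := by
  rw [schurSeries, ← coeff_zero_eq_constantCoeff_apply, coeff_subst' hasSubst_tSeries,
    finsum_eq_single _ 0]
  · simp
  · intro n hn
    have : constantCoeff tSeries = 0 := by simp [tSeries]
    simp [this, hn]

/-- Uniqueness for the linear differential equation `df = f s` in formal power series. -/
theorem eq_zero_of_derivative_eq_mul {R : Type*} [CommRing R] [IsAddTorsionFree R]
    {f s : PowerSeries R} (h : derivative R f = f * s) (h0 : constantCoeff f = 0) : f = 0 := by
  ext n
  induction n using Nat.strong_induction_on with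
  | _ n ih =>
    cases n with
    | zero => simpa using h0
    | succ n =>
      have h1 := congrArg (coeff n) h
      rw [coeff_derivative, coeff_mul, Finset.sum_eq_zero] at h1
      · have h2 : (n + 1) • coeff (n + 1) f = 0 := by
          rw [nsmul_eq_mul, mul_comm]; exact_mod_cast h1
        exact nsmul_right_injective n.succ_ne_zero (h2.trans (nsmul_zero _).symm)
      · intro x hx
        have := Finset.HasAntidiagonal.mem_antidiagonal.mp hx
        rw [ih x.1 (by omega)]
        simp

/-- Apply a partial derivative to all the coefficients of a power series. -/
def pderivCoeff (k : ℕ) (f : PowerSeries (MvPolynomial ℕ ℂ)) : PowerSeries (MvPolynomial ℕ ℂ) :=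
  PowerSeries.mk fun n => MvPolynomial.pderiv k (coeff n f)

theorem pderivCoeff_mul (k : ℕ) (f g : PowerSeries (MvPolynomial ℕ ℂ)) :
    pderivCoeff k (f * g) = pderivCoeff k f * g + f * pderivCoeff k g := by
  ext1 n
  simp only [pderivCoeff, coeff_mk, coeff_mul, map_add, map_sum, ← Finset.sum_add_distrib,
    Derivation.leibniz, smul_eq_mul]
  refine Finset.sum_congr rfl fun x _ => by ring

theorem pderivCoeff_derivative (k : ℕ) (f : PowerSeries (MvPolynomial ℕ ℂ)) :
    pderivCoeff k (derivative _ f) = derivative _ (pderivCoeff k f) := by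
  ext1 n
  simp only [pderivCoeff, coeff_mk, coeff_derivative, Derivation.leibniz, smul_eq_mul]
  have : MvPolynomial.pderiv k ((n : MvPolynomial ℕ ℂ) + 1) = 0 := by
    simp
  rw [this]
  ring

theorem pderivCoeff_tSeries {k : ℕ} (hk : 0 < k) : pderivCoeff k tSeries = X ^ k := by
  ext1 n
  rw [pderivCoeff, coeff_mk, tSeries, coeff_mk, coeff_X_pow]
  rcases eq_or_ne n k with rfl | h
  · simp [hk.ne']
  · by_cases hn : n = 0
    · simp [hn, hk.ne]
    · simp [hn, h, MvPolynomial.pderiv_X_of_ne h]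

/-- `∂/∂t_k` commutes with `d/dz`, so the difference of the two sides solves `df = f · tSeries'`
with zero constant term, and uniqueness applies. -/
theorem pderivCoeff_schurSeries {k : ℕ} (hk : 0 < k) :
    pderivCoeff k schurSeries = X ^ k * schurSeries := by
  rw [← sub_eq_zero]
  refine eq_zero_of_derivative_eq_mul (s := derivative _ tSeries) ?_ ?_
  · rw [map_sub, ← pderivCoeff_derivative, derivative_schurSeries, pderivCoeff_mul,
      pderivCoeff_derivative k tSeries, pderivCoeff_tSeries hk, Derivation.leibniz,
      derivative_schurSeries]
    simp only [smul_eq_mul]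
    ring
  · rw [map_sub, map_mul, map_pow, constantCoeff_X, zero_pow hk.ne', zero_mul, sub_zero,
      ← coeff_zero_eq_constantCoeff_apply, pderivCoeff, coeff_mk,
      coeff_zero_eq_constantCoeff_apply, constantCoeff_schurSeries, Derivation.map_one_eq_zero]

theorem schurP_natCast (n : ℕ) : schurP n = coeff n schurSeries := by
  simp [schurP, schurSeries]

theorem schurP_of_neg {n : ℤ} (hn : n < 0) : schurP n = 0 := by
  simp [schurP, not_le.mpr hn]

/-- `∂ p_n / ∂ t_k = p_{n-k}`. -/
theorem pderiv_schurP {k : ℕ} (hk : 0 < k) (n : ℤ) :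
    MvPolynomial.pderiv k (schurP n) = schurP (n - k) := by
  rcases lt_or_ge n 0 with hn | hn
  · rw [schurP_of_neg hn, schurP_of_neg (by omega), map_zero]
  · lift n to ℕ using hn
    have h := congrArg (coeff n) (pderivCoeff_schurSeries hk)
    rw [pderivCoeff, coeff_mk, coeff_X_pow_mul'] at h
    rw [schurP_natCast, h]
    split_ifs with h1
    · rw [← schurP_natCast, Nat.cast_sub h1]
    · rw [schurP_of_neg (by omega)]

/-- The polynomial `∏ (1 - x_i z)`. -/
def onePoly {k : ℕ} (x : Fin k → ℂ) : Polynomial ℂ :=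
  ∏ i, (1 - Polynomial.C (x i) * Polynomial.X)

theorem natDegree_onePoly_le {k : ℕ} (x : Fin k → ℂ) : (onePoly x).natDegree ≤ k := by
  refine (Polynomial.natDegree_prod_le _ _).trans ?_
  refine (Finset.sum_le_card_nsmul _ _ 1 fun i _ => ?_).trans (by simp)
  compute_degree

theorem coeff_zero_onePoly {k : ℕ} (x : Fin k → ℂ) : (onePoly x).coeff 0 = 1 := by
  simp [onePoly, Polynomial.coeff_zero_eq_eval_zero, Polynomial.eval_prod]

/-- The logarithmic derivative of `∏ (1 - x_i z)`, cleared of denominators: the factor `i`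
contributes the geometric series of `x_i / (1 - x_i z)`. -/
theorem sum_geom_mul_prod {ι : Type*} (x : ι → ℂ) (s : Finset ι) :
    (∑ i ∈ s, PowerSeries.mk fun n => x i ^ (n + 1)) * ∏ i ∈ s, (1 - C (x i) * X) =
      -derivative ℂ (∏ i ∈ s, (1 - C (x i) * X)) := by
  classical
  induction s using Finset.induction_on with
  | empty => simp
  | insert a s ha ih =>
    have hgeom : (PowerSeries.mk fun n => x a ^ (n + 1)) * (1 - C (x a) * X) = C (x a) := by
      ext n
      cases n with
      | zero => simp
      | succ n =>
        rw [mul_sub, mul_one, ← mul_assoc, map_sub, coeff_succ_mul_X, coeff_mul_C]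
        simp [pow_succ]
    have hd : derivative ℂ (1 - C (x a) * X) = - C (x a) := by
      simp [Derivation.leibniz]
    rw [Finset.sum_insert ha, Finset.prod_insert ha, Derivation.leibniz, hd]
    simp only [smul_eq_mul]
    linear_combination (∏ i ∈ s, (1 - C (x i) * X)) * hgeom + (1 - C (x a) * X) * ih

/-- At `∑ [x_i]` the exponent has derivative `∑ x_i / (1 - x_i z)`, the negative of the logarithmic
derivative of `∏ (1 - x_i z)`. The product thus has derivative 0 and constant term 1. -/
theorem map_schurSeries_mul {k : ℕ} (x : Fin k → ℂ) :
    PowerSeries.map (MvPolynomial.eval (bracketSum x)) schurSeries * (onePoly x : PowerSeries ℂ)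
      = 1 := by
  set φ := MvPolynomial.eval (bracketSum x)
  have hcoe : (onePoly x : PowerSeries ℂ) = ∏ i, (1 - C (x i) * X) := by
    rw [onePoly, ← Polynomial.coeToPowerSeries.ringHom_apply, map_prod]
    simp
  have hmap : ∀ f : PowerSeries (MvPolynomial ℕ ℂ),
      derivative ℂ (PowerSeries.map φ f) = PowerSeries.map φ (derivative _ f) := by
    intro f
    ext n
    simp [coeff_derivative]
  have hT : PowerSeries.map φ (derivative _ tSeries) =
      ∑ i, PowerSeries.mk fun n => x i ^ (n + 1) := by
    ext n
    have h1 : ((n : ℂ) + 1) ≠ 0 := by exact_mod_cast n.succ_ne_zero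
    simp only [coeff_map, coeff_derivative, tSeries, coeff_mk, map_sum, φ]
    simp [bracketSum, Finset.sum_mul, h1]
  refine derivative.ext ?_ ?_
  · rw [Derivation.leibniz, hmap, derivative_schurSeries, map_mul, hT, hcoe]
    simp only [smul_eq_mul, Derivation.map_one_eq_zero]
    linear_combination (PowerSeries.map φ schurSeries) * sum_geom_mul_prod x Finset.univ
  · rw [map_mul, ← coeff_zero_eq_constantCoeff_apply, coeff_map,
      coeff_zero_eq_constantCoeff_apply, constantCoeff_schurSeries]
    have := coeff_zero_onePoly x
    simp [this]

/-- The values `p_n([x_1] + ⋯ + [x_k])` satisfy a linear recurrence of order `k`. -/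
theorem sum_coeff_mul_eval_schurP {k : ℕ} (x : Fin k → ℂ) {K : ℕ} (hK : k ≤ K) (q : ℤ) :
    ∑ r ∈ Finset.range (K + 1),
        (onePoly x).coeff r * MvPolynomial.eval (bracketSum x) (schurP (q - r)) =
      if q = 0 then 1 else 0 := by
  rcases lt_or_ge q 0 with hq | hq
  · rw [if_neg hq.ne]
    refine Finset.sum_eq_zero fun r _ => ?_
    rw [schurP_of_neg (by omega)]
    simp
  · lift q to ℕ using hq
    have h := congrArg (coeff q) (map_schurSeries_mul x)
    rw [mul_comm, coeff_mul, coeff_one, Finset.Nat.sum_antidiagonal_eq_sum_range_succ_mk] at h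
    simp only [Polynomial.coeff_coe, coeff_map] at h
    simp only [Nat.cast_eq_zero]
    rw [← h]
    -- Terms beyond `K` vanish by the degree bound and terms beyond `q` by negative index, so the
    -- sums up to `K` and up to `q` agree.
    have hz : ∀ r, min K q < r → (onePoly x).coeff r *
        MvPolynomial.eval (bracketSum x) (schurP ((q : ℤ) - r)) = 0 := by
      intro r hr
      rcases min_lt_iff.mp hr with h1 | h1
      · rw [Polynomial.coeff_eq_zero_of_natDegree_lt
          (((natDegree_onePoly_le x).trans hK).trans_lt h1), zero_mul]
      · rw [schurP_of_neg (by omega), map_zero, mul_zero]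
    have hs : ∀ L, min K q ≤ L → ∑ r ∈ Finset.range (L + 1), (onePoly x).coeff r *
          MvPolynomial.eval (bracketSum x) (schurP ((q : ℤ) - r)) =
        ∑ r ∈ Finset.range (min K q + 1), (onePoly x).coeff r *
          MvPolynomial.eval (bracketSum x) (schurP ((q : ℤ) - r)) := by
      intro L hL
      symm
      refine Finset.sum_subset (Finset.range_mono (by omega)) fun r _ hr => hz r ?_
      rw [Finset.mem_range] at hr
      omega
    rw [hs K (min_le_left _ _), ← hs q (min_le_right _ _)]
    refine Finset.sum_congr rfl fun r hr => ?_
    rw [← Nat.cast_sub (by simpa [Nat.lt_succ_iff] using hr), schurP_natCast]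

end GeneratingSeries

/-! ### Determinants given by row labels, and their derivatives. -/

section Determinants

theorem derivation_prod {R A ι : Type*} [CommRing R] [CommRing A] [Algebra R A] [DecidableEq ι]
    (D : Derivation R A A) (s : Finset ι) (f : ι → A) :
    D (∏ i ∈ s, f i) = ∑ r ∈ s, ∏ i ∈ s, if i = r then D (f i) else f i := by
  induction s using Finset.induction_on with
  | empty => simp
  | insert a s ha ih =>
    rw [Finset.prod_insert ha, Derivation.leibniz, ih, Finset.sum_insert ha, Finset.prod_insert ha,
      if_pos rfl, smul_eq_mul, smul_eq_mul, add_comm, Finset.mul_sum]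
    congr 1
    · rw [mul_comm]
      congr 1
      exact Finset.prod_congr rfl fun i hi => by rw [if_neg (ne_of_mem_of_not_mem hi ha)]
    · refine Finset.sum_congr rfl fun r hr => ?_
      rw [Finset.prod_insert ha, if_neg (ne_of_mem_of_not_mem hr ha).symm]

/-- A derivation acts on a determinant row by row. -/
theorem derivation_det {R A ι : Type*} [CommRing R] [CommRing A] [Algebra R A] [Fintype ι]
    [DecidableEq ι] (D : Derivation R A A) (M : Matrix ι ι A) :
    D M.det = ∑ r, (M.updateRow r fun j => D (M r j)).det := by
  have hdet : ∀ M : Matrix ι ι A,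
      M.det = ∑ σ : Equiv.Perm ι, Equiv.Perm.sign σ • ∏ i, M i (σ i) := fun M => by
    rw [← Matrix.det_transpose, Matrix.det_apply]; rfl
  simp only [hdet]
  rw [map_sum, Finset.sum_comm]
  refine Finset.sum_congr rfl fun σ _ => ?_
  rw [Units.smul_def, map_zsmul, derivation_prod, Finset.smul_sum]
  refine Finset.sum_congr rfl fun r _ => ?_
  rw [Units.smul_def]
  congr 1
  refine Finset.prod_congr rfl fun i _ => ?_
  rw [Matrix.updateRow_apply]
  split_ifs with h
  · rw [h]
  · rfl

/-- The determinant `det (p_{β_r - (N - 1) + j})`. For `β_r = μ_r + N - 1 - r` it is the Schur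
function of `μ`. -/
def betaDet {N : ℕ} (β : Fin N → ℤ) : MvPolynomial ℕ ℂ :=
  Matrix.det (Matrix.of fun r j : Fin N => schurP (β r - ((N : ℤ) - 1) + (j : ℤ)))

theorem schur_eq_betaDet (l : ℕ) (μ : ℕ → ℕ) :
    schur l μ = betaDet fun r : Fin l => (μ r : ℤ) + ((l : ℤ) - 1) - r := by
  rw [schur, betaDet]
  congr
  ext1 r
  ext1 j
  congr 1
  ring

/-- Differentiating a row shifts all its indices by `-a`, which is the same as lowering the label of
that row. -/
theorem pderiv_betaDet {N : ℕ} (β : Fin N → ℤ) {a : ℕ} (ha : 0 < a) :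
    MvPolynomial.pderiv a (betaDet β) = ∑ r, betaDet (Function.update β r (β r - a)) := by
  rw [betaDet, derivation_det]
  refine Finset.sum_congr rfl fun r _ => ?_
  rw [betaDet]
  congr 1
  ext1 i j
  rw [Matrix.updateRow_apply, Matrix.of_apply, Matrix.of_apply, Matrix.of_apply,
    Function.update_apply]
  split_ifs with h
  · rw [pderiv_schurP ha]
    congr 1
    ring
  · rfl

theorem partialT_sum {ι : Type*} (I : List ℕ) (s : Finset ι) (F : ι → MvPolynomial ℕ ℂ) :
    partialT I (∑ r ∈ s, F r) = ∑ r ∈ s, partialT I (F r) := by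
  induction I with
  | nil => rfl
  | cons a I ih =>
    change MvPolynomial.pderiv a (partialT I (∑ r ∈ s, F r)) = _
    rw [ih, map_sum]
    rfl

theorem partialT_concat (I : List ℕ) (a : ℕ) (F : MvPolynomial ℕ ℂ) :
    partialT (I ++ [a]) F = partialT I (MvPolynomial.pderiv a F) := by
  simp [partialT]

theorem partialT_concat_betaDet {N : ℕ} (β : Fin N → ℤ) (I : List ℕ) {a : ℕ} (ha : 0 < a) :
    partialT (I ++ [a]) (betaDet β) =
      ∑ r, partialT I (betaDet (Function.update β r (β r - a))) := by
  rw [partialT_concat, pderiv_betaDet β ha, partialT_sum]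

theorem betaDet_eq_zero_of_eq {N : ℕ} {β : Fin N → ℤ} {r s : Fin N} (hrs : r ≠ s)
    (h : β r = β s) : betaDet β = 0 :=
  Matrix.det_zero_of_row_eq hrs (by ext1 j; simp [h])

variable {k n : ℕ}

/-- At a sum of `k` points, column operations turn all but the first `k` columns into columns of
zeros and ones. -/
theorem eval_betaDet (x : Fin k → ℂ) (β : Fin (k + n) → ℤ) :
    MvPolynomial.eval (bracketSum x) (betaDet β) =
      Matrix.det (Matrix.of fun r j : Fin (k + n) =>
        if (j : ℕ) < k then
          MvPolynomial.eval (bracketSum x) (schurP (β r - (((k + n : ℕ) : ℤ) - 1) + (j : ℤ)))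
        else if β r = ((k + n : ℕ) : ℤ) - 1 - j then 1 else 0) := by
  set P : ℤ → ℂ := fun q => MvPolynomial.eval (bracketSum x) (schurP q) with hP
  let M : Matrix (Fin (k + n)) (Fin (k + n)) ℂ :=
    Matrix.of fun r j => P (β r - (((k + n : ℕ) : ℤ) - 1) + (j : ℤ))
  -- A unipotent matrix of column operations: the first `k` columns are kept, and column `j ≥ k` is
  -- combined with the columns to its left by the coefficients of `∏ (1 - x_i z)`.
  let T : Matrix (Fin (k + n)) (Fin (k + n)) ℂ := Matrix.of fun i j =>
    if (j : ℕ) < k then (if i = j then 1 else 0)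
    else if i ≤ j then (onePoly x).coeff ((j : ℕ) - i) else 0
  have hT : T.det = 1 := by
    rw [Matrix.det_of_isUpperTriangular]
    · refine Finset.prod_eq_one fun i _ => ?_
      simp [T, coeff_zero_onePoly]
    · intro i j hij
      have h1 : ¬ i ≤ j := not_le.mpr hij
      have h2 : i ≠ j := (ne_of_lt hij).symm
      simp [T, h1, h2]
  have hM : MvPolynomial.eval (bracketSum x) (betaDet β) = M.det := by
    rw [betaDet, RingHom.map_det]
    rfl
  rw [hM, show M.det = (M * T).det by rw [Matrix.det_mul, hT, mul_one]]
  congr 1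
  ext1 r j
  rw [Matrix.mul_apply, Matrix.of_apply]
  by_cases hj : (j : ℕ) < k
  · rw [if_pos hj]
    simp [M, T, hj, hP]
  · rw [if_neg hj]
    -- The recurrence with cutoff `K = j`: as `j ≥ k`, there are enough columns to the left to hold
    -- all its terms.
    have h1 := sum_coeff_mul_eval_schurP x (not_lt.mp hj) (β r - (((k + n : ℕ) : ℤ) - 1) + (j : ℤ))
    have h2 : (β r - (((k + n : ℕ) : ℤ) - 1) + (j : ℤ) = 0) ↔
        β r = ((k + n : ℕ) : ℤ) - 1 - j := by omega
    simp only [h2] at h1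
    rw [← h1, ← Finset.sum_range_reflect]
    have h3 : ∀ i : Fin (k + n), M r i * T i j =
        (fun i : ℕ => if i ≤ j then P (β r - (((k + n : ℕ) : ℤ) - 1) + (i : ℤ)) *
          (onePoly x).coeff ((j : ℕ) - i) else 0) i := by
      intro i
      simp only [M, T, Matrix.of_apply, hj, if_false, Fin.le_def]
      split_ifs <;> simp
    rw [Finset.sum_congr rfl fun i _ => h3 i, Fin.sum_univ_eq_sum_range (fun i : ℕ =>
        if i ≤ j then P (β r - (((k + n : ℕ) : ℤ) - 1) + (i : ℤ)) *
          (onePoly x).coeff ((j : ℕ) - i) else 0),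
      ← Finset.sum_subset (Finset.range_mono (show (j : ℕ) + 1 ≤ k + n by omega))]
    · refine Finset.sum_congr rfl fun i hi => ?_
      have hi' : i ≤ j := by simpa [Nat.lt_succ_iff] using hi
      rw [if_pos hi', mul_comm]
      have h4 : (j : ℕ) + 1 - 1 - i = j - i := by omega
      rw [h4, Nat.cast_sub hi']
      congr 2
      ring
    · intro i _ hi
      rw [Finset.mem_range] at hi
      rw [if_neg (by omega)]

/-- Pigeonhole: in a non-zero term of the expansion each of the `n` indicator columns uses a row
with label below `n`, which leaves only `k` columns for the rows with large labels. -/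
theorem eval_betaDet_eq_zero (x : Fin k → ℂ) (β : Fin (k + n) → ℤ)
    (h : k < (Finset.univ.filter fun r => (n : ℤ) ≤ β r).card) :
    MvPolynomial.eval (bracketSum x) (betaDet β) = 0 := by
  rw [eval_betaDet, Matrix.det_apply]
  refine Finset.sum_eq_zero fun σ _ => ?_
  by_contra hne
  have hprod : ∀ j : Fin (k + n), ¬ (j : ℕ) < k → β (σ j) < n := by
    intro j hj
    by_contra hlt
    refine hne ?_
    rw [Finset.prod_eq_zero (Finset.mem_univ j), smul_zero]
    rw [Matrix.of_apply, if_neg hj, if_neg]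
    push_cast
    omega
  have hle : (Finset.univ.filter fun r => (n : ℤ) ≤ β r).card ≤
      (Finset.univ.filter fun j : Fin (k + n) => (j : ℕ) < k).card := by
    refine Finset.card_le_card_of_injOn (fun r => σ.symm r) (fun r hr => ?_)
      (σ.symm.injective.injOn)
    simp only [Finset.coe_filter, Finset.mem_univ, true_and, Set.mem_ofPred_eq] at hr ⊢
    by_contra hlt
    have := hprod _ hlt
    simp only [Equiv.apply_symm_apply] at this
    omega
  have hcard : (Finset.univ.filter fun j : Fin (k + n) => (j : ℕ) < k).card ≤ k := by
    refine (Finset.card_le_card_of_injOn (fun j : Fin (k + n) => (j : ℕ))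
      (t := Finset.range k) (fun j hj => by simpa using hj) (Fin.val_injective.injOn)).trans ?_
    simp
  omega

/-- Moving one entry down removes at most one element from the set of large entries. -/
theorem card_filter_le_card_filter_update {N : ℕ} (β : Fin N → ℤ) (c : ℤ) (r : Fin N) (v : ℤ) :
    (Finset.univ.filter fun s => c ≤ β s).card ≤
      (Finset.univ.filter fun s => c ≤ Function.update β r v s).card + 1 := by
  refine le_trans (Finset.card_le_card (t := insert r
    (Finset.univ.filter fun s => c ≤ Function.update β r v s)) ?_) (Finset.card_insert_le _ _)
  intro s hs
  by_cases h : s = r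
  · simp [h]
  · simpa [h, Function.update_of_ne] using hs

/-- If the entry `r` is small before, or large after the move, no large entry is lost. -/
theorem card_filter_le_card_filter_update_of {N : ℕ} (β : Fin N → ℤ) (c : ℤ) (r : Fin N) (v : ℤ)
    (h : β r < c ∨ c ≤ v) :
    (Finset.univ.filter fun s => c ≤ β s).card ≤
      (Finset.univ.filter fun s => c ≤ Function.update β r v s).card := by
  refine Finset.card_le_card fun s hs => ?_
  by_cases hsr : s = r
  · subst hsr
    simp only [Finset.mem_filter, Finset.mem_univ, true_and, Function.update_self] at hs ⊢
    omega
  · simpa [hsr, Function.update_of_ne] using hs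

/-- Each derivative makes at most one large label small, so more than `k` large labels remain at the
end. -/
theorem eval_partialT_eq_zero_of_card (x : Fin k → ℂ) (I : List ℕ) (hI : ∀ i ∈ I, 0 < i)
    (β : Fin (k + n) → ℤ)
    (h : k + I.length < (Finset.univ.filter fun r => (n : ℤ) ≤ β r).card) :
    MvPolynomial.eval (bracketSum x) (partialT I (betaDet β)) = 0 := by
  induction I using List.reverseRecOn generalizing β with
  | nil => exact eval_betaDet_eq_zero x β (by simpa using h)
  | append_singleton I a ih =>
    rw [partialT_concat_betaDet β I (hI a (by simp)), map_sum]
    refine Finset.sum_eq_zero fun r _ => ih (fun i hi => hI i (by simp [hi])) _ ?_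
    have := card_filter_le_card_filter_update β n r (β r - a)
    rw [List.length_append, List.length_singleton] at h
    omega

/-- There is no derivative to spare: one spent on a small row leaves too many large labels. In the
remaining terms the two equal small rows are never touched and the determinant has equal rows. -/
theorem eval_partialT_eq_zero_of_bad (x : Fin k → ℂ) (I : List ℕ) (hI : ∀ i ∈ I, 0 < i)
    (β : Fin (k + n) → ℤ)
    (h : k + I.length ≤ (Finset.univ.filter fun r => (n : ℤ) ≤ β r).card)
    (hbad : ∃ r s, r ≠ s ∧ β r = β s ∧ β r < n) :
    MvPolynomial.eval (bracketSum x) (partialT I (betaDet β)) = 0 := by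
  obtain ⟨r, s, hrs, heq, hlt⟩ := hbad
  induction I using List.reverseRecOn generalizing β with
  | nil =>
    change MvPolynomial.eval (bracketSum x) (betaDet β) = 0
    rw [betaDet_eq_zero_of_eq hrs heq, map_zero]
  | append_singleton I a ih =>
    have hI' : ∀ i ∈ I, 0 < i := fun i hi => hI i (by simp [hi])
    rw [List.length_append, List.length_singleton] at h
    rw [partialT_concat_betaDet β I (hI a (by simp)), map_sum]
    refine Finset.sum_eq_zero fun q _ => ?_
    by_cases hq : β q < n
    · refine eval_partialT_eq_zero_of_card x I hI' _ ?_
      have := card_filter_le_card_filter_update_of β n q (β q - a) (Or.inl hq)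
      omega
    · have hrq : r ≠ q := by rintro rfl; exact hq hlt
      have hsq : s ≠ q := by rintro rfl; exact hq (heq ▸ hlt)
      refine ih hI' _ ?_ ?_ ?_
      · have := card_filter_le_card_filter_update β n q (β q - a)
        omega
      · rw [Function.update_of_ne hrq, Function.update_of_ne hsq, heq]
      · rwa [Function.update_of_ne hrq]

/-- Differentiating along `B_0 - c_0, …, B_{m-1} - c_{m-1}` lowers the rows with entries
`B_0 > ⋯ > B_{m-1} ≥ n` to the missing small values `c_0, …, c_{m-1}`, and no other term
survives. -/
theorem eval_partialT_aSeq (x : Fin k → ℂ) (c : ℕ → ℕ) (m : ℕ) (hm : m ≤ n)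
    (β : Fin (k + n) → ℤ) (a : ℕ → ℕ)
    (ha : ∀ i (hi : i < m), (a i : ℤ) = β ⟨k + i, by omega⟩ - c i)
    (hc : StrictMonoOn c (Set.Iio m)) (hcn : ∀ i < m, c i < n)
    (hlarge : ∀ r : Fin (k + n), (r : ℕ) < k + m → (n : ℤ) ≤ β r)
    (hsmall : ∀ r : Fin (k + n), k + m ≤ (r : ℕ) → β r < n)
    (hanti : ∀ r s : Fin (k + n), r < s → (s : ℕ) < k + m → β s < β r)
    (hocc : ∀ v : ℕ, v < n → (∀ i < m, v ≠ c i) → ∃ s : Fin (k + n), k + m ≤ (s : ℕ) ∧ β s = v) :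
    MvPolynomial.eval (bracketSum x) (partialT ((List.range m).map a) (betaDet β)) =
      MvPolynomial.eval (bracketSum x)
        (betaDet fun r => if k ≤ (r : ℕ) ∧ (r : ℕ) < k + m then (c (r - k) : ℤ) else β r) := by
  induction m generalizing β with
  | zero =>
    have : ∀ r : Fin (k + n), ¬ (k ≤ (r : ℕ) ∧ (r : ℕ) < k + 0) := fun r => by omega
    simp only [this, if_false]
    rfl
  | succ m ih =>
    -- `R` carries the smallest large label. The last entry `a m` of the list acts first and moves
    -- this label to `c m`; then the induction hypothesis applies with `c m` among the occupied
    -- values.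
    set R : Fin (k + n) := ⟨k + m, by omega⟩ with hR
    have hapos : ∀ i < m + 1, 0 < a i := by
      intro i hi
      have h1 := ha i hi
      have h2 := hlarge ⟨k + i, by omega⟩ (by simpa using hi)
      have h3 := hcn i hi
      omega
    have ham : (a m : ℤ) = β R - c m := ha m (by omega)
    have hcard : k + m + 1 ≤ (Finset.univ.filter fun r => (n : ℤ) ≤ β r).card := by
      refine le_trans (le_of_eq ?_) (Finset.card_le_card (s := Finset.univ.filter
        fun r : Fin (k + n) => (r : ℕ) < k + m + 1) ?_)
      · rw [Fin.card_filter_val_lt]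
        omega
      · intro r hr
        simp only [Finset.mem_filter, Finset.mem_univ, true_and] at hr ⊢
        exact hlarge r hr
    have hpos : ∀ i ∈ (List.range m).map a, 0 < i := by
      intro i hi
      obtain ⟨j, hj, rfl⟩ := List.mem_map.mp hi
      exact hapos j (by have := List.mem_range.mp hj; omega)
    have hlen : ((List.range m).map a).length = m := by simp
    rw [List.range_succ, List.map_append, List.map_singleton,
      partialT_concat_betaDet β _ (hapos m (by omega)), map_sum, Finset.sum_eq_single R]
    · rw [ih (by omega)]
      · congr 2
        ext1 r
        by_cases hr : r = R
        · subst hr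
          simp [R, ham]
        · have hr' : (r : ℕ) ≠ k + m := fun h => hr (Fin.ext h)
          rw [Function.update_of_ne hr]
          by_cases h1 : k ≤ (r : ℕ) ∧ (r : ℕ) < k + m
          · rw [if_pos h1, if_pos (by omega)]
          · rw [if_neg h1, if_neg (by omega)]
      · intro i hi
        rw [Function.update_of_ne (by simp [R, Fin.ext_iff]; omega), ha i (by omega)]
      · exact hc.mono fun i hi => by simp only [Set.mem_Iio] at hi ⊢; omega
      · exact fun i hi => hcn i (by omega)
      · intro r hr
        rw [Function.update_of_ne (by simp [R, Fin.ext_iff]; omega)]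
        exact hlarge r (by omega)
      · intro r hr
        by_cases hrR : r = R
        · have := hcn m (by omega)
          rw [hrR, Function.update_self]
          omega
        · rw [Function.update_of_ne hrR]
          have : (r : ℕ) ≠ k + m := fun h => hrR (Fin.ext h)
          exact hsmall r (by omega)
      · intro r s hrs hs
        have := Fin.lt_def.mp hrs
        rw [Function.update_of_ne (by simp [R, Fin.ext_iff]; omega),
          Function.update_of_ne (by simp [R, Fin.ext_iff]; omega)]
        exact hanti r s hrs (by omega)
      · intro v hv hne
        by_cases hvm : v = c m
        · exact ⟨R, by simp [R], by simp [ham, hvm]⟩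
        · obtain ⟨s, hs, hsv⟩ := hocc v hv fun i hi => by
            rcases Nat.lt_succ_iff_lt_or_eq.mp hi with h | h
            · exact hne i h
            · rwa [h]
          exact ⟨s, by omega, by rwa [Function.update_of_ne (by simp [R, Fin.ext_iff]; omega)]⟩
    · intro r _ hr
      have hr' : (r : ℕ) ≠ k + m := fun h => hr (Fin.ext h)
      -- A move that does not cross `n` leaves at least `k + m + 1` large labels for only `m`
      -- further derivatives.
      by_cases hkeep : β r < n ∨ (n : ℤ) ≤ β r - a m
      · refine eval_partialT_eq_zero_of_card x _ hpos _ ?_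
        have := card_filter_le_card_filter_update_of β n r (β r - a m) hkeep
        omega
      · push Not at hkeep
        rcases lt_or_ge (r : ℕ) (k + m) with hlt | hge
        -- A label above that of `R` lands strictly between `c m` and `n`. Every missing value is at
        -- most `c m`, so the landing place is the label of some small row.
        · have h1 : β R < β r := hanti r R (Fin.lt_def.mpr hlt) (by simp [R])
          obtain ⟨v, hv⟩ : ∃ v : ℕ, (v : ℤ) = β r - a m := ⟨(β r - a m).toNat, by omega⟩
          obtain ⟨s, hs, hsv⟩ := hocc v (by omega) fun i hi => by
            have : c i ≤ c m := hc.monotoneOn hi (show m < m + 1 by omega) (by omega)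
            omega
          have hsr : s ≠ r := by simp [Fin.ext_iff]; omega
          refine eval_partialT_eq_zero_of_bad x _ hpos _ ?_ ⟨r, s, hsr.symm, ?_, ?_⟩
          · have := card_filter_le_card_filter_update β n r (β r - a m)
            omega
          · rw [Function.update_self, Function.update_of_ne hsr, hsv, hv]
          · rw [Function.update_self]
            exact hkeep.2
        · have := hsmall r (by omega)
          omega
    · simp

end Determinants

/-! ### Derivatives of Schur functions at sums of points and at the origin. -/

section SchurFunctions

theorem schurP_zero : schurP 0 = 1 := by
  have := schurP_natCast 0
  rw [Nat.cast_zero] at this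
  rw [this, PowerSeries.coeff_zero_eq_constantCoeff_apply, constantCoeff_schurSeries]

/-- The last row is `(0, …, 0, 1)`: negative indices to the left of `p_0`. -/
theorem schur_succ {l : ℕ} {μ : ℕ → ℕ} (h : μ l = 0) : schur (l + 1) μ = schur l μ := by
  rw [schur, Matrix.det_succ_row _ (Fin.last l), Finset.sum_eq_single (Fin.last l)]
  · simp only [Matrix.of_apply, Fin.val_last, h, Nat.cast_zero, zero_sub, neg_add_cancel,
      schurP_zero, mul_one, Fin.succAbove_last, ← two_mul, pow_mul, neg_one_sq, one_pow, one_mul]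
    rfl
  · intro j _ hj
    have : (j : ℕ) < l := by
      have h1 := j.is_lt
      have h2 : (j : ℕ) ≠ l := fun h => hj (Fin.ext (by simpa using h))
      omega
    rw [Matrix.of_apply, Fin.val_last, h, schurP_of_neg (by omega), mul_zero, zero_mul]
  · simp

theorem schur_add {l : ℕ} {μ : ℕ → ℕ} (h : ∀ i, l ≤ i → μ i = 0) (d : ℕ) :
    schur (l + d) μ = schur l μ := by
  induction d with
  | zero => rfl
  | succ d ih => rw [← add_assoc, schur_succ (h _ (by omega)), ih]

/-- The Schur function does not depend on the number of zeros at the end of the partition. -/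
theorem schur_congr_length {l l' : ℕ} {μ : ℕ → ℕ} (h : ∀ i, l ≤ i → μ i = 0)
    (h' : ∀ i, l' ≤ i → μ i = 0) : schur l μ = schur l' μ := by
  rw [← schur_add h l', ← schur_add h' l, add_comm]

theorem bracketSum_elim0 (x : Fin 0 → ℂ) : bracketSum x = 0 := by
  ext n
  simp [bracketSum]

variable {k n : ℕ}

/-- The value of the determinant once the last `n` rows have the entries `0, …, n - 1` in the
order given by `τ`. -/
theorem eval_betaDet_perm (x : Fin k → ℂ) (μ : ℕ → ℕ) (τ : Equiv.Perm (Fin n))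
    (β : Fin (k + n) → ℤ)
    (hup : ∀ i : Fin k, β (Fin.castAdd n i) = (μ i : ℤ) + (k + n - 1) - i)
    (hlow : ∀ i : Fin n, β (Fin.natAdd k i) = (τ i : ℕ)) :
    MvPolynomial.eval (bracketSum x) (betaDet β) =
      ((Equiv.Perm.sign (Fin.revPerm * τ) : ℤ) : ℂ) *
        MvPolynomial.eval (bracketSum x) (schur k μ) := by
  rw [eval_betaDet, ← Matrix.det_submatrix_equiv_self finSumFinEquiv,
    ← Matrix.fromBlocks_toBlocks (Matrix.submatrix _ _ _)]
  -- The first `k` labels are `≥ n`, so these rows vanish in the indicator columns. The lower right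
  -- block is the matrix of the permutation `rev ∘ τ`.
  rw [show Matrix.toBlocks₁₂ _ = 0 from ?_, Matrix.det_fromBlocks_zero₁₂, mul_comm]
  · congr 1
    · rw [← Matrix.det_permutation]
      congr 1
      ext i j
      have := (τ i).is_lt
      have := j.is_lt
      simp only [Matrix.toBlocks₂₂, Matrix.submatrix_apply, Matrix.of_apply,
        finSumFinEquiv_apply_right, Fin.val_natAdd, hlow, PEquiv.toMatrix_apply,
        Equiv.toPEquiv_apply, Option.mem_def, Option.some.injEq, Equiv.Perm.mul_apply,
        Fin.revPerm_apply, Fin.ext_iff, Fin.val_rev]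
      rw [if_neg (by omega)]
      congr 1
      rw [eq_iff_iff]
      push_cast
      omega
    · rw [schur, RingHom.map_det]
      congr 1
      ext i j
      simp only [Matrix.toBlocks₁₁, Matrix.submatrix_apply, Matrix.of_apply,
        finSumFinEquiv_apply_left, Fin.val_castAdd, hup, RingHom.mapMatrix_apply, Matrix.map_apply]
      rw [if_pos j.is_lt]
      congr 2
      push_cast
      ring
  · ext i j
    have := i.is_lt
    simp only [Matrix.toBlocks₁₂, Matrix.submatrix_apply, Matrix.of_apply,
      finSumFinEquiv_apply_left, finSumFinEquiv_apply_right, Fin.val_natAdd, hup, Matrix.zero_apply]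
    rw [if_neg (by omega), if_neg]
    push_cast
    omega

/-- The derivative of a Schur function along the sequence `b_{n-1-i} - c_i`, where the numbers
`b_0 < ⋯ < b_{n-1}` contain all `v < n` but `c_0 < ⋯ < c_{m-1}`. -/
theorem exists_perm_eval_partialT_schur (b c : ℕ → ℕ) (m : ℕ) (hm : m ≤ n)
    (hb : StrictMonoOn b (Set.Iio n)) (hc : StrictMonoOn c (Set.Iio m))
    (hbsmall : ∀ j, j + m < n → b j < n) (hblarge : ∀ j < n, n ≤ j + m → n ≤ b j)
    (hcn : ∀ i < m, c i < n) (hbc : ∀ i < m, ∀ j < n, c i ≠ b j)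
    (hocc : ∀ v < n, (∀ i < m, v ≠ c i) → ∃ j, j + m < n ∧ b j = v) :
    ∃ σ : Equiv.Perm (Fin n),
      (∀ i : Fin n, ((σ.symm (Fin.rev i) : Fin n) : ℕ) =
        if (i : ℕ) < m then c i else b (n - 1 - i)) ∧
      ∀ (l : ℕ) (μ : ℕ → ℕ), IsPartition l μ →
        (∀ i < n, μ (k + i) = b (n - 1 - i) - (n - 1 - i)) → (∀ i, k + n ≤ i → μ i = 0) →
        ∀ x : Fin k → ℂ,
          MvPolynomial.eval (bracketSum x)
              (partialT ((List.range m).map fun i => b (n - 1 - i) - c i) (schur l μ)) =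
            ((Equiv.Perm.sign σ : ℤ) : ℂ) * MvPolynomial.eval (bracketSum x) (schur k μ) := by
  have htop : ∀ i : Fin n, (if (i : ℕ) < m then c i else b (n - 1 - i)) < n := by
    intro i
    split_ifs with h
    · exact hcn i h
    · exact hbsmall _ (by omega)
  let f : Fin n → Fin n := fun i => ⟨_, htop i⟩
  have hf : Function.Injective f := by
    intro i j hij
    have h : (if (i : ℕ) < m then c i else b (n - 1 - i)) =
        if (j : ℕ) < m then c j else b (n - 1 - j) := congrArg Fin.val hij
    have hi := i.is_lt
    have hj := j.is_lt
    split_ifs at h with h1 h2 h2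
    · exact Fin.ext (hc.injOn h1 h2 h)
    · exact absurd h (hbc i h1 _ (by omega))
    · exact absurd h.symm (hbc j h2 _ (by omega))
    · have := hb.injOn (show n - 1 - i < n by omega) (show n - 1 - j < n by omega) h
      exact Fin.ext (by omega)
  let τ : Equiv.Perm (Fin n) := Equiv.ofBijective f (Finite.injective_iff_bijective.mp hf)
  have hτ : ∀ i : Fin n, ((τ i : Fin n) : ℕ) = if (i : ℕ) < m then c i else b (n - 1 - i) :=
    fun i => rfl
  have hble : ∀ j < n, j ≤ b j := by
    intro j hj
    induction j with
    | zero => omega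
    | succ j ih =>
      have h1 := ih (by omega)
      have h2 : b j < b (j + 1) := hb (show j < n by omega) hj (by omega)
      omega
  -- With `τ` the upper row, `σ = rev ∘ τ⁻¹` sends the entry `τ i` to the entry `rev i` below it; it
  -- has the sign of `rev ∘ τ`.
  refine ⟨(Fin.revPerm.trans τ).symm, fun i => ?_, fun l μ hμ hμb hμ0 x => ?_⟩
  · rw [← hτ]
    simp
  -- With exactly `k + n` rows the label of each row `r ≥ k` is the entry `k + n - 1 - r` of `b`.
  rw [schur_congr_length hμ.2 hμ0, schur_eq_betaDet]
  set β : Fin (k + n) → ℤ := fun r => (μ r : ℤ) + (((k + n : ℕ) : ℤ) - 1) - r with hβ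
  have hβb : ∀ r : Fin (k + n), k ≤ (r : ℕ) → β r = b (k + n - 1 - r) := by
    intro r hr
    have hrn := r.is_lt
    have h1 := hμb (r - k) (by omega)
    rw [show k + ((r : ℕ) - k) = r by omega, show n - 1 - ((r : ℕ) - k) = k + n - 1 - r by omega]
      at h1
    have h2 := hble (k + n - 1 - r) (by omega)
    simp only [hβ, h1]
    omega
  have hβanti : ∀ r s : Fin (k + n), r < s → β s < β r := by
    intro r s hrs
    have h1 : (μ s) ≤ μ r := hμ.1 (Fin.le_def.mp hrs.le)
    have h2 := Fin.lt_def.mp hrs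
    simp only [hβ]
    omega
  rw [eval_partialT_aSeq x c m hm β]
  · rw [eval_betaDet_perm x μ τ]
    · congr 3
      rw [show (Fin.revPerm.trans τ).symm = (τ * Fin.revPerm)⁻¹ from rfl, Equiv.Perm.sign_inv,
        Equiv.Perm.sign_mul, Equiv.Perm.sign_mul, mul_comm]
    · intro i
      have := i.is_lt
      rw [if_neg (by simp only [Fin.val_castAdd]; omega)]
      simp only [hβ, Fin.val_castAdd]
      push_cast
      ring
    · intro i
      have := i.is_lt
      rw [hτ]
      by_cases hi : (i : ℕ) < m
      · rw [if_pos (by simp only [Fin.val_natAdd]; omega), if_pos hi]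
        simp
      · rw [if_neg (by simp only [Fin.val_natAdd]; omega), if_neg hi,
          hβb _ (by simp only [Fin.val_natAdd]; omega)]
        congr 2
        simp only [Fin.val_natAdd]
        omega
  · intro i hi
    rw [hβb _ (by simp)]
    have h1 := hblarge (n - 1 - i) (by omega) (by omega)
    have h2 := hcn i hi
    rw [show k + n - 1 - (k + i) = n - 1 - i by omega]
    omega
  · exact hc
  · exact hcn
  · intro r hr
    rcases lt_or_ge (r : ℕ) k with h | h
    · rcases Nat.eq_zero_or_pos n with hn | hn
      · simp only [hβ]
        omega
      · have h1 := hβanti r ⟨k, by omega⟩ (Fin.lt_def.mpr h)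
        rw [hβb ⟨k, by omega⟩ le_rfl] at h1
        have h2 := hble (n - 1) (by omega)
        rw [show k + n - 1 - ((⟨k, by omega⟩ : Fin (k + n)) : ℕ) = n - 1 by simp; omega] at h1
        omega
    · rw [hβb r h]
      exact_mod_cast hblarge _ (by omega) (by omega)
  · intro r hr
    have := r.is_lt
    rw [hβb r (by omega)]
    exact_mod_cast hbsmall _ (by omega)
  · exact fun r s hrs _ => hβanti r s hrs
  · intro v hv hne
    obtain ⟨j, hj, hjv⟩ := hocc v hv hne
    refine ⟨⟨k + (n - 1 - j), by omega⟩, by simp only; omega, ?_⟩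
    rw [hβb _ (by simp), ← hjv]
    congr 2
    simp only
    omega

/-- Derivatives at `0` of a weight other than `|μ|` vanish. -/
theorem eval_zero_partialT_betaDet {N : ℕ} (β : Fin N → ℤ) (I : List ℕ) (hI : ∀ i ∈ I, 0 < i)
    (h : ∑ r, β r ≠ ∑ r : Fin N, (r : ℤ) + I.sum) :
    MvPolynomial.eval (0 : ℕ → ℂ) (partialT I (betaDet β)) = 0 := by
  induction I using List.reverseRecOn generalizing β with
  | nil =>
    -- The origin is the sum of no points, so `k = 0` and every column is an indicator. A non-zero
    -- term forces the labels to be `0, …, N - 1` in some order, which fixes their sum.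
    rw [← bracketSum_elim0 Fin.elim0]
    obtain ⟨N', hN'⟩ : ∃ N', 0 + N' = N := ⟨N, zero_add N⟩
    subst hN'
    change MvPolynomial.eval _ (betaDet β) = 0
    rw [eval_betaDet, Matrix.det_apply]
    refine Finset.sum_eq_zero fun σ _ => ?_
    by_contra hne
    refine h ?_
    have hσ : ∀ j, β (σ j) = (Fin.rev j : ℕ) := by
      intro j
      by_contra hj
      refine hne ?_
      rw [Finset.prod_eq_zero (Finset.mem_univ j), smul_zero]
      rw [Matrix.of_apply, if_neg (by omega), if_neg]
      rw [Fin.val_rev] at hj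
      omega
    rw [← Equiv.sum_comp σ β, Finset.sum_congr rfl fun j _ => hσ j,
      ← Equiv.sum_comp Fin.revPerm (fun r : Fin (0 + N') => ((r : ℕ) : ℤ))]
    simp
  | append_singleton I a ih =>
    rw [partialT_concat_betaDet β I (hI a (by simp)), map_sum]
    refine Finset.sum_eq_zero fun r _ => ih _ (fun i hi => hI i (by simp [hi])) fun hsum => h ?_
    rw [Finset.sum_update_of_mem (Finset.mem_univ r)] at hsum
    rw [← Finset.add_sum_erase _ _ (Finset.mem_univ r), ← Finset.sdiff_singleton_eq_erase]
    rw [List.sum_append, List.sum_singleton, Nat.cast_add]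
    linarith

theorem eval_zero_partialT_schur_of_sum_ne {l : ℕ} {μ : ℕ → ℕ} {I : List ℕ}
    (hI : ∀ i ∈ I, 0 < i) (h : I.sum ≠ ∑ i ∈ Finset.range l, μ i) :
    MvPolynomial.eval (0 : ℕ → ℂ) (partialT I (schur l μ)) = 0 := by
  rw [schur_eq_betaDet]
  refine eval_zero_partialT_betaDet _ I hI fun hsum => h ?_
  have h1 : ∑ r : Fin l, (((l : ℤ) - 1) - r) = ∑ r : Fin l, (r : ℤ) := by
    rw [← Equiv.sum_comp Fin.revPerm (fun r : Fin l => ((r : ℕ) : ℤ))]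
    refine Finset.sum_congr rfl fun r _ => ?_
    rw [Fin.revPerm_apply, Fin.val_rev]
    omega
  simp only [add_sub_assoc] at hsum
  rw [Finset.sum_add_distrib, h1, Fin.sum_univ_eq_sum_range (fun i => ((μ i : ℕ) : ℤ))] at hsum
  have : (∑ i ∈ Finset.range l, (μ i : ℤ)) = I.sum := by linarith
  exact_mod_cast this.symm

/-- Derivatives at `0` of low order vanish. -/
theorem eval_zero_partialT_schur_of_length_lt {l : ℕ} {μ : ℕ → ℕ} {I : List ℕ} {m : ℕ}
    (hI : ∀ i ∈ I, 0 < i) (hIm : I.length < m) (hμ : ∀ i, l ≤ i → μ i = 0)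
    (hm : ∀ i < m, i < μ i) :
    MvPolynomial.eval (0 : ℕ → ℂ) (partialT I (schur l μ)) = 0 := by
  have hml : m ≤ l := by
    by_contra hlt
    have h1 := hm l (by omega)
    rw [hμ l le_rfl] at h1
    omega
  rw [← bracketSum_elim0 Fin.elim0, show schur l μ = schur (0 + l) μ by rw [zero_add],
    schur_eq_betaDet]
  -- Here `k = 0` and the label `μ_i + l - 1 - i` is `≥ l` exactly when `i < μ_i`.
  refine eval_partialT_eq_zero_of_card (n := l) _ I hI _ ?_
  rw [zero_add]
  refine lt_of_lt_of_le hIm ?_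
  refine le_trans (le_of_eq ?_) (Finset.card_le_card (s := Finset.univ.filter
    fun r : Fin (0 + l) => (r : ℕ) < m) ?_)
  · rw [Fin.card_filter_val_lt]
    omega
  · intro r hr
    simp only [Finset.mem_filter, Finset.mem_univ, true_and] at hr ⊢
    have := hm r hr
    push_cast
    omega

end SchurFunctions

/-! ### The antiholomorphic derivative and residues in the plane. -/

section Plane

open MeasureTheory Complex

/-- The antiholomorphic derivative `∂u/∂x + i ∂u/∂y` (twice the usual `∂̄ u`). -/
def dbar (u : ℂ → ℂ) (z : ℂ) : ℂ := fderiv ℝ u z 1 + I * fderiv ℝ u z I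

theorem dbar_congr {u v : ℂ → ℂ} {z : ℂ} (h : u =ᶠ[𝓝 z] v) : dbar u z = dbar v z := by
  rw [dbar, dbar, h.fderiv_eq]

theorem dbar_eq_zero_of_eventually_const {u : ℂ → ℂ} {z c : ℂ} (h : ∀ᶠ w in 𝓝 z, u w = c) :
    dbar u z = 0 := by
  rw [dbar_congr (v := fun _ => c) h]
  simp [dbar]

theorem dbar_of_differentiableAt {u : ℂ → ℂ} {z : ℂ} (h : DifferentiableAt ℂ u z) :
    dbar u z = 0 := by
  rw [dbar, h.fderiv_restrictScalars ℝ]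
  have : fderiv ℂ u z I = I * fderiv ℂ u z 1 := by
    simpa only [smul_eq_mul, mul_one] using (fderiv ℂ u z).map_smul I 1
  rw [ContinuousLinearMap.coe_restrictScalars', this, ← mul_assoc, I_mul_I]
  ring

theorem dbar_mul {u v : ℂ → ℂ} {z : ℂ} (hu : DifferentiableAt ℝ u z)
    (hv : DifferentiableAt ℝ v z) :
    dbar (fun w => u w * v w) z = dbar u z * v z + u z * dbar v z := by
  rw [dbar, dbar, dbar, show (fun w => u w * v w) = u * v from rfl, fderiv_mul hu hv]
  simp only [add_apply, smul_apply, smul_eq_mul]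
  ring

theorem dbar_sub {u v : ℂ → ℂ} {z : ℂ} (hu : DifferentiableAt ℝ u z)
    (hv : DifferentiableAt ℝ v z) :
    dbar (fun w => u w - v w) z = dbar u z - dbar v z := by
  rw [dbar, dbar, dbar, show (fun w => u w - v w) = u - v from rfl, fderiv_sub hu hv]
  simp only [sub_apply]
  ring

theorem dbar_sum {ι : Type*} {s : Finset ι} {u : ι → ℂ → ℂ} {z : ℂ}
    (hu : ∀ i ∈ s, DifferentiableAt ℝ (u i) z) :
    dbar (fun w => ∑ i ∈ s, u i w) z = ∑ i ∈ s, dbar (u i) z := by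
  simp only [dbar]
  rw [fderiv_fun_sum hu, Finset.sum_add_distrib, sum_apply,
    sum_apply, Finset.mul_sum]

/-- The chain rule for the antiholomorphic derivative and a holomorphic inner function. -/
theorem dbar_comp {u τ : ℂ → ℂ} {z : ℂ} (hu : DifferentiableAt ℝ u (τ z))
    (hτ : DifferentiableAt ℂ τ z) :
    dbar (fun w => u (τ w)) z = (starRingEnd ℂ) (deriv τ z) * dbar u (τ z) := by
  have hc := fderiv_comp z hu (hτ.restrictScalars ℝ)
  rw [hτ.fderiv_restrictScalars ℝ] at hc
  rw [dbar, dbar, show (fun w => u (τ w)) = u ∘ τ from rfl, hc]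
  set L := fderiv ℝ u (τ z)
  have h1 : fderiv ℂ τ z 1 = deriv τ z := fderiv_apply_one_eq_deriv
  have hI : fderiv ℂ τ z I = I * deriv τ z := by
    simpa only [smul_eq_mul, mul_one, h1] using (fderiv ℂ τ z).map_smul I 1
  simp only [ContinuousLinearMap.comp_apply, ContinuousLinearMap.coe_restrictScalars', h1, hI]
  set a := deriv τ z
  have hL : ∀ w : ℂ, L w = w.re * L 1 + w.im * L I := by
    intro w
    have : w = w.re • (1 : ℂ) + w.im • I := by
      simp [Complex.re_add_im]
    conv_lhs => rw [this]
    rw [map_add, map_smul, map_smul, Complex.real_smul, Complex.real_smul]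
  rw [hL a, hL (I * a)]
  simp only [mul_re, I_re, zero_mul, I_im, one_mul, zero_sub, mul_im, zero_add, ofReal_neg]
  have hconj : (starRingEnd ℂ) a = a.re - a.im * I := by
    apply Complex.ext <;> simp
  rw [hconj]
  linear_combination (a.im * L I) * I_mul_I

theorem continuousAt_dbar {u : ℂ → ℂ} {z : ℂ} (hu : ContDiffAt ℝ 1 u z) :
    ContinuousAt (dbar u) z := by
  have h : ContinuousAt (fderiv ℝ u) z := hu.continuousAt_fderiv one_ne_zero
  exact (h.clm_apply continuousAt_const).add
    (continuousAt_const.mul (h.clm_apply continuousAt_const))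

theorem tsupport_dbar_subset (u : ℂ → ℂ) : tsupport (dbar u) ⊆ tsupport u := by
  refine closure_minimal (fun z hz => ?_) (isClosed_tsupport u)
  by_contra hzu
  refine hz (dbar_eq_zero_of_eventually_const (c := 0) ?_)
  exact notMem_tsupport_iff_eventuallyEq.mp hzu

theorem notMem_tsupport_dbar {u : ℂ → ℂ} {z c : ℂ} (h : ∀ᶠ w in 𝓝 z, u w = c) :
    z ∉ tsupport (dbar u) := by
  rw [notMem_tsupport_iff_eventuallyEq]
  filter_upwards [eventually_eventually_nhds.mpr h] with w hw
  exact dbar_eq_zero_of_eventually_const hw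

/-- Stokes' theorem for compactly supported functions in the plane. -/
theorem integral_dbar_eq_zero {u : ℂ → ℂ} (hu : ContDiff ℝ 1 u) (hc : HasCompactSupport u) :
    ∫ z, dbar u z = 0 := by
  have hcont : Continuous (fderiv ℝ u) := hu.continuous_fderiv one_ne_zero
  have hInt : ∀ v : ℂ, Integrable fun z => fderiv ℝ u z v := fun v =>
    (hcont.clm_apply continuous_const).integrable_of_hasCompactSupport
      (hc.fderiv_apply (𝕜 := ℝ) v)
  have hzero : ∀ v : ℂ, ∫ z, fderiv ℝ u z v = 0 := by
    intro v
    -- Integration by parts against the constant function 1.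
    have h := integral_mul_fderiv_eq_neg_fderiv_mul_of_integrable (μ := volume) (𝕜 := ℂ)
      (f := fun _ : ℂ => (1 : ℂ)) (g := u) (v := v) (by simp)
      (by simpa using hInt v)
      (by simpa using hu.continuous.integrable_of_hasCompactSupport hc)
      (fun x _ => differentiableAt_const _)
      (fun x _ => hu.differentiable one_ne_zero x)
    simpa using h
  simp only [dbar]
  rw [integral_add (hInt 1) ((hInt I).const_mul I), integral_const_mul, hzero, hzero]
  simp

/-- `h` may be singular wherever `ψ` is locally constant; this admits poles at the centre of a
cutoff. -/
theorem continuous_dbar_mul {ψ h : ℂ → ℂ} (hψ : ContDiff ℝ 1 ψ)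
    (hh : ∀ z ∈ tsupport (dbar ψ), ContinuousAt h z) :
    Continuous fun z => dbar ψ z * h z := by
  rw [continuous_iff_continuousAt]
  intro z
  by_cases hz : z ∈ tsupport (dbar ψ)
  · exact (continuousAt_dbar hψ.contDiffAt).mul (hh z hz)
  · have : (fun z => dbar ψ z * h z) =ᶠ[𝓝 z] fun _ => 0 := by
      filter_upwards [notMem_tsupport_iff_eventuallyEq.mp hz] with w hw
      rw [hw]
      simp
    exact continuousAt_const.congr this.symm

theorem integrable_dbar_mul {ψ h : ℂ → ℂ} (hψ : ContDiff ℝ 1 ψ) (hc : HasCompactSupport ψ)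
    (hh : ∀ z ∈ tsupport (dbar ψ), ContinuousAt h z) :
    Integrable fun z => dbar ψ z * h z := by
  refine (continuous_dbar_mul hψ hh).integrable_of_hasCompactSupport ?_
  exact HasCompactSupport.mul_right (hc.mono' (subset_closure.trans (tsupport_dbar_subset ψ)))

/-- Stokes for `ψη`: since `η` is holomorphic on the support of `ψ`, `∂̄(ψη) = ∂̄ψ · η` everywhere.
-/
theorem integral_dbar_mul_eq_zero {ψ η : ℂ → ℂ} (hψ : ContDiff ℝ 1 ψ) (hc : HasCompactSupport ψ)
    (hη : ∀ z ∈ tsupport ψ, AnalyticAt ℂ η z) : ∫ z, dbar ψ z * η z = 0 := by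
  have hlocal : ∀ z, z ∉ tsupport ψ → (fun w => ψ w * η w) =ᶠ[𝓝 z] fun _ => 0 := by
    intro z hz
    filter_upwards [notMem_tsupport_iff_eventuallyEq.mp hz] with w hw
    rw [hw]
    simp
  have hu : ContDiff ℝ 1 fun w => ψ w * η w := by
    rw [contDiff_iff_contDiffAt]
    intro z
    by_cases hz : z ∈ tsupport ψ
    · exact hψ.contDiffAt.mul ((hη z hz).contDiffAt.restrict_scalars ℝ)
    · exact contDiffAt_const.congr_of_eventuallyEq (hlocal z hz)
  have hdbar : ∀ z, dbar (fun w => ψ w * η w) z = dbar ψ z * η z := by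
    intro z
    by_cases hz : z ∈ tsupport ψ
    · have hd := (hη z hz).differentiableAt
      rw [dbar_mul (hψ.differentiable one_ne_zero z) (hd.restrictScalars ℝ),
        dbar_of_differentiableAt hd, mul_zero, add_zero]
    · rw [dbar_eq_zero_of_eventually_const (hlocal z hz), dbar_eq_zero_of_eventually_const
        (notMem_tsupport_iff_eventuallyEq.mp hz), zero_mul]
  rw [← integral_dbar_eq_zero hu hc.mul_right]
  exact integral_congr_ae (Filter.Eventually.of_forall fun z => (hdbar z).symm)

/-- A radial cutoff function in the plane. -/
def cutoff (z : ℂ) : ℂ := (Real.smoothTransition (2 - normSq z) : ℝ)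

theorem contDiff_normSq : ContDiff ℝ 1 normSq := by
  have : (normSq : ℂ → ℝ) = fun z => z.re * z.re + z.im * z.im := by
    ext z; exact normSq_apply z
  rw [this]
  exact (reCLM.contDiff.mul reCLM.contDiff).add (imCLM.contDiff.mul imCLM.contDiff)

theorem contDiff_cutoff : ContDiff ℝ 1 cutoff :=
  ofRealCLM.contDiff.comp
    ((Real.smoothTransition.contDiff (n := 1)).comp (contDiff_const.sub contDiff_normSq))

theorem cutoff_eventually_eq_one : ∀ᶠ z in 𝓝 (0 : ℂ), cutoff z = 1 := by
  have : ∀ᶠ z : ℂ in 𝓝 0, normSq z < 1 :=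
    (continuous_normSq.tendsto 0).eventually_lt_const (by simp)
  filter_upwards [this] with z hz
  rw [cutoff, Real.smoothTransition.one_of_one_le (by linarith), ofReal_one]

theorem hasCompactSupport_cutoff : HasCompactSupport cutoff := by
  refine HasCompactSupport.intro (isCompact_closedBall (0 : ℂ) 2) fun z hz => ?_
  have h2 : 2 < ‖z‖ := by simpa using hz
  rw [cutoff, Real.smoothTransition.zero_of_nonpos, ofReal_zero]
  rw [normSq_eq_norm_sq]
  nlinarith

/-- The integral `∫ ∂̄ψ / z` for a cutoff function `ψ` at `0`. -/
def resConst : ℂ := ∫ z, dbar cutoff z * z⁻¹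

theorem dbar_cutoff (z : ℂ) :
    dbar cutoff z = -2 * (deriv Real.smoothTransition (2 - normSq z) : ℝ) * z := by
  have hN : HasFDerivAt (fun z : ℂ => 2 - normSq z)
      (-((z.re • reCLM + z.re • reCLM) + (z.im • imCLM + z.im • imCLM))) z := by
    have h := ((reCLM.hasFDerivAt (x := z)).mul (reCLM.hasFDerivAt (x := z))).add
      ((imCLM.hasFDerivAt (x := z)).mul (imCLM.hasFDerivAt (x := z)))
    have h' := h.const_sub 2
    exact h'.congr_of_eventuallyEq (Filter.Eventually.of_forall fun w => by simp [normSq_apply])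
  have hs : HasDerivAt Real.smoothTransition
      (deriv Real.smoothTransition (2 - normSq z)) (2 - normSq z) :=
    ((Real.smoothTransition.contDiff (n := 1)).differentiable one_ne_zero _).hasDerivAt
  have h := ofRealCLM.hasFDerivAt.comp z (hs.comp_hasFDerivAt z hN)
  have h' : HasFDerivAt cutoff _ z := h
  rw [dbar, h'.fderiv]
  simp only [ContinuousLinearMap.comp_apply, smul_apply,
    neg_apply, add_apply, reCLM_apply, imCLM_apply,
    ofRealCLM_apply, one_re, one_im, I_re, I_im, smul_eq_mul]
  generalize deriv Real.smoothTransition (2 - normSq z) = d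
  conv_rhs => rw [← re_add_im z]
  push_cast
  ring

/-- Off the origin the integrand is `-2 s'(2 - |z|²)` with `s` the monotone transition function, so
it has constant sign. Its exact integral is irrelevant. -/
theorem resConst_ne_zero : resConst ≠ 0 := by
  set s' : ℝ → ℝ := deriv Real.smoothTransition with hs'
  have hdiff : Differentiable ℝ Real.smoothTransition :=
    (Real.smoothTransition.contDiff (n := 1)).differentiable one_ne_zero
  have hs'cont : Continuous s' :=
    (Real.smoothTransition.contDiff (n := 1)).continuous_deriv le_rfl
  have hs'nonneg : ∀ t, 0 ≤ s' t := fun t => Real.smoothTransition.monotone.deriv_nonneg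
  have hs'zero : ∀ t, 1 < t → s' t = 0 := by
    intro t ht
    have : Real.smoothTransition =ᶠ[𝓝 t] fun _ => 1 := by
      filter_upwards [lt_mem_nhds ht] with w hw
      exact Real.smoothTransition.one_of_one_le hw.le
    rw [hs', this.deriv_eq]
    simp
  have hs'neg : ∀ t, t < 0 → s' t = 0 := by
    intro t ht
    have : Real.smoothTransition =ᶠ[𝓝 t] fun _ => 0 := by
      filter_upwards [gt_mem_nhds ht] with w hw
      exact Real.smoothTransition.zero_of_nonpos (le_of_lt hw)
    rw [hs', this.deriv_eq]
    simp
  have heq : resConst = ((-2 * ∫ z : ℂ, s' (2 - normSq z) : ℝ) : ℂ) := by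
    rw [resConst]
    push_cast
    rw [← integral_complex_ofReal, ← integral_const_mul]
    congr 1
    ext z
    rw [dbar_cutoff]
    by_cases hz : z = 0
    · subst hz
      simp [← hs', hs'zero 2 (by norm_num)]
    · rw [mul_assoc, mul_inv_cancel₀ hz, mul_one]
  -- By the mean value theorem, as the transition rises from 0 to 1; the integrand is then non-zero
  -- at the point `√(2 - t)`.
  obtain ⟨t, ht, ht'⟩ : ∃ t ∈ Set.Ioo (0 : ℝ) 1, s' t = 1 := by
    have := exists_deriv_eq_slope Real.smoothTransition (zero_lt_one)
      Real.smoothTransition.continuous.continuousOn hdiff.differentiableOn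
    simpa using this
  have hpos : 0 < ∫ z : ℂ, s' (2 - normSq z) := by
    refine Continuous.integral_pos_of_hasCompactSupport_nonneg_nonzero
      (x := ((Real.sqrt (2 - t) : ℝ) : ℂ)) (hs'cont.comp (continuous_const.sub continuous_normSq))
      ?_ (fun z => hs'nonneg _) ?_
    · refine HasCompactSupport.intro (isCompact_closedBall (0 : ℂ) 2) fun z hz => ?_
      have h2 : 2 < ‖z‖ := by simpa using hz
      apply hs'neg
      rw [normSq_eq_norm_sq]
      nlinarith
    · rw [normSq_ofReal, Real.mul_self_sqrt (by linarith [ht.2]), sub_sub_cancel, ht']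
      exact one_ne_zero
  rw [heq]
  exact_mod_cast (by linarith : -2 * ∫ z : ℂ, s' (2 - normSq z) < 0).ne

/-- Independence of the cutoff: two of them differ by a function that vanishes near `z₀`, and on its
support `1/(z - z₀)` is holomorphic. -/
theorem integral_dbar_mul_inv_sub {ψ : ℂ → ℂ} {z₀ : ℂ} (hψ : ContDiff ℝ 1 ψ)
    (hc : HasCompactSupport ψ) (h1 : ∀ᶠ z in 𝓝 z₀, ψ z = 1) :
    ∫ z, dbar ψ z * (z - z₀)⁻¹ = resConst := by
  set χ : ℂ → ℂ := fun z => cutoff (z - z₀) with hχ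
  have hχd : ContDiff ℝ 1 χ := contDiff_cutoff.comp (contDiff_id.sub contDiff_const)
  have hχc : HasCompactSupport χ :=
    hasCompactSupport_cutoff.comp_homeomorph (Homeomorph.subRight z₀)
  have hχ1 : ∀ᶠ z in 𝓝 z₀, χ z = 1 := by
    have : Filter.Tendsto (fun z => z - z₀) (𝓝 z₀) (𝓝 0) := by
      simpa using (continuous_sub_right z₀).tendsto z₀
    exact this.eventually cutoff_eventually_eq_one
  have hdχ : ∀ z, dbar χ z = dbar cutoff (z - z₀) := by
    intro z
    rw [hχ, dbar_comp (τ := fun w => w - z₀) (contDiff_cutoff.differentiable one_ne_zero _)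
      (differentiableAt_id.sub_const z₀)]
    simp
  have hcont : ∀ z, z ≠ z₀ → AnalyticAt ℂ (fun z => (z - z₀)⁻¹) z := fun z hz =>
    (analyticAt_id.sub analyticAt_const).inv (sub_ne_zero.mpr hz)
  have hne : ∀ {φ : ℂ → ℂ} {c : ℂ}, (∀ᶠ z in 𝓝 z₀, φ z = c) → ∀ z ∈ tsupport (dbar φ), z ≠ z₀ := by
    rintro φ c hφ z hz rfl
    exact notMem_tsupport_dbar hφ hz
  have hdiff : ∫ z, dbar (fun z => ψ z - χ z) z * (z - z₀)⁻¹ = 0 := by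
    refine integral_dbar_mul_eq_zero (hψ.sub hχd) (hc.sub hχc) fun z hz => hcont z ?_
    rintro rfl
    refine (notMem_tsupport_iff_eventuallyEq.mpr ?_) hz
    filter_upwards [h1, hχ1] with w hw1 hw2
    simp [hw1, hw2]
  have hI1 := integrable_dbar_mul hψ hc fun z hz => (hcont z (hne h1 z hz)).continuousAt
  have hI2 := integrable_dbar_mul hχd hχc fun z hz => (hcont z (hne hχ1 z hz)).continuousAt
  have hsplit : ∀ z, dbar (fun z => ψ z - χ z) z * (z - z₀)⁻¹ =
      dbar ψ z * (z - z₀)⁻¹ - dbar χ z * (z - z₀)⁻¹ := fun z => by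
    rw [dbar_sub (hψ.differentiable one_ne_zero z) (hχd.differentiable one_ne_zero z), sub_mul]
  simp only [hsplit] at hdiff
  rw [integral_sub hI1 hI2, sub_eq_zero] at hdiff
  rw [hdiff, resConst]
  simp only [hdχ]
  exact integral_sub_right_eq_self (fun z => dbar cutoff z * z⁻¹) z₀

/-- The residue of a simple pole as an integral. -/
theorem integral_dbar_mul_of_simple_pole {ψ η g : ℂ → ℂ} {z₀ a : ℂ} (hψ : ContDiff ℝ 1 ψ)
    (hc : HasCompactSupport ψ) (h1 : ∀ᶠ z in 𝓝 z₀, ψ z = 1)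
    (hη : ∀ z ∈ tsupport ψ, z ≠ z₀ → AnalyticAt ℂ η z) (hg : AnalyticAt ℂ g z₀)
    (hpole : ∀ᶠ z in 𝓝[≠] z₀, η z = a / (z - z₀) + g z) :
    ∫ z, dbar ψ z * η z = a * resConst := by
  classical
  set θ : ℂ → ℂ := Function.update (fun z => η z - a * (z - z₀)⁻¹) z₀ (g z₀) with hθ
  have hθan : ∀ z ∈ tsupport ψ, AnalyticAt ℂ θ z := by
    intro z hz
    by_cases hzz : z = z₀
    · subst hzz
      refine hg.congr ?_
      rw [eventually_nhdsWithin_iff] at hpole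
      filter_upwards [hpole] with w hw
      by_cases hwz : w = z
      · simp [hθ, hwz]
      · rw [hθ, Function.update_of_ne hwz, hw hwz]
        ring
    · refine ((hη z hz hzz).sub ((analyticAt_const (v := a)).mul
        ((analyticAt_id.sub analyticAt_const).inv (sub_ne_zero.mpr hzz)))).congr ?_
      filter_upwards [isOpen_ne.mem_nhds hzz] with w hw
      rw [hθ, Function.update_of_ne hw]
      rfl
  have hzero : dbar ψ z₀ = 0 := dbar_eq_zero_of_eventually_const h1
  have hsplit : ∀ z, dbar ψ z * η z = dbar ψ z * θ z + a * (dbar ψ z * (z - z₀)⁻¹) := by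
    intro z
    by_cases hz : z = z₀
    · simp [hz, hzero]
    · rw [hθ, Function.update_of_ne hz]
      ring
  simp only [hsplit]
  rw [integral_add, integral_dbar_mul_eq_zero hψ hc hθan, integral_const_mul,
    integral_dbar_mul_inv_sub hψ hc h1, zero_add]
  · exact integrable_dbar_mul hψ hc fun z hz => (hθan z (tsupport_dbar_subset ψ hz)).continuousAt
  · refine (integrable_dbar_mul hψ hc fun z hz => ?_).const_mul a
    have hzz : z ≠ z₀ := by
      rintro rfl
      exact notMem_tsupport_dbar h1 hz
    exact ((continuousAt_id.sub continuousAt_const).inv₀ (sub_ne_zero.mpr hzz))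

end Plane

/-! ### The residue theorem on a compact Riemann surface. -/

section ResidueTheorem

open MeasureTheory Set

variable {X : Type*} [TopologicalSpace X] [ChartedSpace ℂ X] [IsManifold 𝓘(ℂ) ω X]

theorem contDiffOn_transition {e e' : OpenPartialHomeomorph X ℂ} (he : e ∈ atlas ℂ X)
    (he' : e' ∈ atlas ℂ X) : ContDiffOn ℂ ω (e.symm ≫ₕ e') (e.symm ≫ₕ e').source := by
  have h := (mem_groupoid_of_pregroupoid.mp
    (HasGroupoid.compatible (G := contDiffGroupoid ω 𝓘(ℂ)) he he')).1
  simpa [contDiffPregroupoid] using h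

theorem analyticAt_transition {e e' : OpenPartialHomeomorph X ℂ} (he : e ∈ atlas ℂ X)
    (he' : e' ∈ atlas ℂ X) {z : ℂ} (hz : z ∈ e.target) (hz' : e.symm z ∈ e'.source) :
    AnalyticAt ℂ (fun w => e' (e.symm w)) z := by
  have hmem : z ∈ (e.symm ≫ₕ e').source := by
    rw [OpenPartialHomeomorph.trans_source]
    exact ⟨hz, hz'⟩
  exact ((contDiffOn_transition he he').contDiffAt
    ((e.symm ≫ₕ e').open_source.mem_nhds hmem)).analyticAt

/-- A Riemann surface is a smooth real manifold. -/
theorem isManifold_real : IsManifold 𝓘(ℝ, ℂ) ∞ X := by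
  refine isManifold_of_contDiffOn _ _ _ fun e e' he he' => ?_
  have h := ((contDiffOn_transition he he').restrict_scalars ℝ).of_le
    (show (∞ : WithTop ℕ∞) ≤ ω from le_top)
  simpa using h

theorem contDiffAt_comp_chart_symm {f : X → ℝ} (hf : ContMDiff 𝓘(ℝ, ℂ) 𝓘(ℝ) ∞ f) (c : X) {z : ℂ}
    (hz : z ∈ (chartAt ℂ c).target) :
    ContDiffAt ℝ 1 (fun w => ((f ((chartAt ℂ c).symm w) : ℝ) : ℂ)) z := by
  have : IsManifold 𝓘(ℝ, ℂ) ∞ X := isManifold_real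
  have h1 : ContMDiffOn 𝓘(ℝ, ℂ) 𝓘(ℝ) ∞ (f ∘ (chartAt ℂ c).symm) (chartAt ℂ c).target :=
    hf.comp_contMDiffOn contMDiffOn_chart_symm
  have h2 := (contMDiffOn_iff_contDiffOn.mp h1).contDiffAt
    ((chartAt ℂ c).open_target.mem_nhds hz)
  have h3 := (Complex.ofRealCLM.contDiff.contDiffAt (n := ∞)).comp z h2
  exact h3.of_le (by exact_mod_cast le_top)

theorem det_restrictScalars_fderiv {τ : ℂ → ℂ} {z : ℂ} :
    ((fderiv ℂ τ z).restrictScalars ℝ).det = Complex.normSq (deriv τ z) := by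
  simp only [ContinuousLinearMap.det]
  have : ((((fderiv ℂ τ z).restrictScalars ℝ : ℂ →L[ℝ] ℂ)) : ℂ →ₗ[ℝ] ℂ) =
    ((fderiv ℂ τ z : ℂ →L[ℂ] ℂ) : ℂ →ₗ[ℂ] ℂ).restrictScalars ℝ := rfl
  rw [this, LinearMap.det_restrictScalars, Algebra.norm_complex_eq,
    LinearMap.det_ring, ← fderiv_apply_one_eq_deriv]
  rfl

/-- The residue theorem for a meromorphic one-form with simple poles on a compact Riemann
surface. The form is given by its local expressions `η c z dz` in the charts around the points
`c`, and `r p` is its residue at `p`. -/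
theorem sum_residue_eq_zero [T2Space X] [CompactSpace X] (P : Finset X) (η : X → ℂ → ℂ)
    (r : X → ℂ)
    (hcomp : ∀ c c' z, z ∈ (chartAt ℂ c).target →
      (chartAt ℂ c).symm z ∈ (chartAt ℂ c').source → (chartAt ℂ c).symm z ∉ P →
      η c z = η c' (chartAt ℂ c' ((chartAt ℂ c).symm z)) *
        deriv (fun w => chartAt ℂ c' ((chartAt ℂ c).symm w)) z)
    (hol : ∀ c z, z ∈ (chartAt ℂ c).target → (chartAt ℂ c).symm z ∉ P → AnalyticAt ℂ (η c) z)
    (hres : ∀ p ∈ P, ∃ g : ℂ → ℂ, AnalyticAt ℂ g (chartAt ℂ p p) ∧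
      ∀ᶠ z in 𝓝[≠] (chartAt ℂ p p), η p z = r p / (z - chartAt ℂ p p) + g z) :
    ∑ p ∈ P, r p = 0 := by
  classical
  have : IsManifold 𝓘(ℝ, ℂ) ∞ X := isManifold_real
  -- a partition of unity which is locally constant near `P`
  let U : X → Set X := fun x => (chartAt ℂ x).source ∩ ((P.erase x : Finset X) : Set X)ᶜ
  have hUo : ∀ x, IsOpen (U x) := fun x =>
    (chartAt ℂ x).open_source.inter (P.erase x).finite_toSet.isClosed.isOpen_compl
  have hUx : ∀ x, x ∈ U x := fun x => ⟨mem_chart_source ℂ x, by simp⟩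
  obtain ⟨ρ, hρ⟩ := SmoothPartitionOfUnity.exists_isSubordinate 𝓘(ℝ, ℂ) (s := (univ : Set X))
    isClosed_univ U hUo fun x _ => mem_iUnion.mpr ⟨x, hUx x⟩
  have hfin : {i | (Function.support (ρ i)).Nonempty}.Finite :=
    ρ.locallyFinite.finite_nonempty_of_compact
  set S : Finset X := hfin.toFinset with hS
  have hρS : ∀ i, i ∉ S → ∀ x, ρ i x = 0 := by
    intro i hi x
    by_contra hne
    exact hi (hfin.mem_toFinset.mpr ⟨x, hne⟩)
  have hsum : ∀ x, ∑ i ∈ S, ρ i x = 1 := by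
    intro x
    rw [← ρ.sum_eq_one (mem_univ x), finsum_eq_sum_of_support_subset]
    intro i hi
    by_contra hne
    exact hi (hρS i hne x)
  have hsrc : ∀ i, tsupport (ρ i) ⊆ (chartAt ℂ i).source := fun i => (hρ i).trans inter_subset_left
  -- `U i` omits every point of `P` other than `i`, so near `p ∈ P` only `ρ p` survives, and it is 1
  -- there.
  have hzero : ∀ p ∈ P, ∀ i, i ≠ p → ∀ᶠ x in 𝓝 p, ρ i x = 0 := by
    intro p hp i hip
    refine notMem_tsupport_iff_eventuallyEq.mp fun hmem => ?_
    exact (hρ i hmem).2 (by simpa [hip.symm] using hp)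
  have hPS : P ⊆ S := by
    intro p hp
    by_contra hpS
    have h := hsum p
    rw [Finset.sum_eq_zero] at h
    · exact zero_ne_one h
    · intro i hi
      exact (hzero p hp i (ne_of_mem_of_not_mem hi hpS)).self_of_nhds
  have hone : ∀ p ∈ P, ∀ᶠ x in 𝓝 p, ρ p x = 1 := by
    intro p hp
    have h : ∀ᶠ x in 𝓝 p, ∀ i ∈ S.erase p, ρ i x = 0 := by
      rw [Filter.eventually_all_finset]
      exact fun i hi => hzero p hp i (Finset.ne_of_mem_erase hi)
    filter_upwards [h] with x hx
    rw [← hsum x, ← Finset.add_sum_erase S _ (hPS hp), Finset.sum_eq_zero hx, add_zero]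
  have hconst : ∀ p ∈ P, ∀ i, ∃ a : ℝ, ∀ᶠ x in 𝓝 p, ρ i x = a := by
    intro p hp i
    by_cases hip : i = p
    · subst hip
      exact ⟨1, hone i hp⟩
    · exact ⟨0, hzero p hp i hip⟩
  -- local expressions
  let v : X → X → ℂ → ℂ := fun i c z => ((ρ i ((chartAt ℂ c).symm z) : ℝ) : ℂ)
  have hv : ∀ (i c : X) (z : ℂ), z ∈ (chartAt ℂ c).target → ContDiffAt ℝ 1 (v i c) z := fun i c z hz =>
    contDiffAt_comp_chart_symm (f := fun x => ρ i x) (ρ i).contMDiff c hz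
  have hsymm : ∀ (c : X) (z : ℂ), z ∈ (chartAt ℂ c).target →
      Filter.Tendsto (chartAt ℂ c).symm (𝓝 z) (𝓝 ((chartAt ℂ c).symm z)) := fun c z hz =>
    ((chartAt ℂ c).continuousAt_symm hz)
  -- The expression of `ρ_k ∂̄ρ_i ∧ η` in the chart at `c`, up to a constant.
  let F : X → X → X → ℂ → ℂ := fun c i k z => v k c z * (dbar (v i c) z * η c z)
  have hG : ∀ (c i : X) (z : ℂ), z ∈ (chartAt ℂ c).target →
      ContinuousAt (fun w => dbar (v i c) w * η c w) z := by
    intro c i z hz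
    by_cases hzP : (chartAt ℂ c).symm z ∈ P
    · obtain ⟨a, ha⟩ := hconst _ hzP i
      have h1 := eventually_eventually_nhds.mpr ((hsymm c z hz).eventually ha)
      have h2 : (fun w => dbar (v i c) w * η c w) =ᶠ[𝓝 z] fun _ => 0 := by
        filter_upwards [h1] with w hw
        rw [dbar_eq_zero_of_eventually_const (c := (a : ℂ)), zero_mul]
        filter_upwards [hw] with y hy
        simp only [v, hy]
      exact continuousAt_const.congr h2.symm
    · exact (continuousAt_dbar (hv i c z hz)).mul (hol c z hz hzP).continuousAt
  have hF : ∀ c i k : X, ContinuousOn (F c i k) (chartAt ℂ c).target := fun c i k z hz =>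
    ((hv k c z hz).continuousAt.mul (hG c i z hz)).continuousWithinAt
  let K : X → Set ℂ := fun c => chartAt ℂ c '' tsupport (ρ c)
  have hK : ∀ c : X, IsCompact (K c) := fun c =>
    (isClosed_tsupport _).isCompact.image_of_continuousOn
      ((chartAt ℂ c).continuousOn.mono (hsrc c))
  have hKt : ∀ c : X, K c ⊆ (chartAt ℂ c).target := by
    rintro c _ ⟨x, hx, rfl⟩
    exact (chartAt ℂ c).map_source (hsrc c hx)
  have hmemK : ∀ (c : X) (z : ℂ), z ∈ (chartAt ℂ c).target → (chartAt ℂ c).symm z ∈ tsupport (ρ c) →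
      z ∈ K c := fun c z hz h => ⟨_, h, (chartAt ℂ c).right_inv hz⟩
  have hnear : ∀ (i c : X) (z : ℂ), z ∈ (chartAt ℂ c).target → (chartAt ℂ c).symm z ∉ tsupport (ρ i) →
      ∀ᶠ w in 𝓝 z, v i c w = 0 := by
    intro i c z hz h
    filter_upwards [(hsymm c z hz).eventually (notMem_tsupport_iff_eventuallyEq.mp h)] with w hw
    simp only [v]
    rw [hw]
    simp
  have hInt : ∀ c i k : X, (c = i ∨ c = k) → IntegrableOn (F c i k) (chartAt ℂ c).target := by
    intro c i k hc
    have h1 : IntegrableOn (F c i k) (K c) :=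
      ((hF c i k).mono (hKt c)).integrableOn_compact (hK c)
    refine h1.of_forall_sdiff_eq_zero (chartAt ℂ c).open_target.measurableSet ?_
    rintro z ⟨hz, hzK⟩
    have h2 : (chartAt ℂ c).symm z ∉ tsupport (ρ c) := fun h => hzK (hmemK c z hz h)
    have h3 := hnear c c z hz h2
    rcases hc with rfl | rfl
    · simp only [F]
      rw [dbar_eq_zero_of_eventually_const h3, zero_mul, mul_zero]
    · simp only [F]
      rw [h3.self_of_nhds, zero_mul]
  -- change of variables
  have hchange : ∀ i k : X, ∫ z in (chartAt ℂ i).target, F i i k z =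
      ∫ z in (chartAt ℂ k).target, F k i k z := by
    intro i k
    set e : OpenPartialHomeomorph ℂ ℂ := (chartAt ℂ i).symm ≫ₕ chartAt ℂ k with he
    have hes : ∀ z, z ∈ e.source ↔
        z ∈ (chartAt ℂ i).target ∧ (chartAt ℂ i).symm z ∈ (chartAt ℂ k).source := by
      intro z
      rw [he, OpenPartialHomeomorph.trans_source]
      rfl
    have het : ∀ z, z ∈ e.target ↔
        z ∈ (chartAt ℂ k).target ∧ (chartAt ℂ k).symm z ∈ (chartAt ℂ i).source := by
      intro z
      rw [he, OpenPartialHomeomorph.trans_target]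
      rfl
    have han : ∀ z ∈ e.source, AnalyticAt ℂ e z := fun z hz =>
      analyticAt_transition (chart_mem_atlas ℂ i) (chart_mem_atlas ℂ k)
        ((hes z).mp hz).1 ((hes z).mp hz).2
    have hleft : ∫ z in (chartAt ℂ i).target, F i i k z = ∫ z in e.source, F i i k z := by
      refine setIntegral_eq_of_subset_of_forall_sdiff_eq_zero
        (chartAt ℂ i).open_target.measurableSet (fun z hz => ((hes z).mp hz).1) ?_
      rintro z ⟨hz, hze⟩
      have h2 : (chartAt ℂ i).symm z ∉ tsupport (ρ k) := fun h =>
        hze ((hes z).mpr ⟨hz, hsrc k h⟩)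
      simp only [F]
      rw [(hnear k i z hz h2).self_of_nhds, zero_mul]
    have hright : ∫ z in (chartAt ℂ k).target, F k i k z = ∫ z in e.target, F k i k z := by
      refine setIntegral_eq_of_subset_of_forall_sdiff_eq_zero
        (chartAt ℂ k).open_target.measurableSet (fun z hz => ((het z).mp hz).1) ?_
      rintro z ⟨hz, hze⟩
      have h2 : (chartAt ℂ k).symm z ∉ tsupport (ρ i) := fun h =>
        hze ((het z).mpr ⟨hz, hsrc i h⟩)
      simp only [F]
      rw [dbar_eq_zero_of_eventually_const (hnear i k z hz h2), zero_mul, mul_zero]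
    rw [hleft, hright, integral_target_eq_integral_abs_det_fderiv_smul volume (f := e)
      (f' := fun z => (fderiv ℂ e z).restrictScalars ℝ)
      (fun z hz => (han z hz).differentiableAt.hasFDerivAt.restrictScalars ℝ)]
    refine setIntegral_congr_fun e.open_source.measurableSet fun z hz => ?_
    obtain ⟨hz1, hz2⟩ := (hes z).mp hz
    have hez : e z = chartAt ℂ k ((chartAt ℂ i).symm z) := rfl
    have heq : ∀ j, v j i =ᶠ[𝓝 z] fun w => v j k (e w) := by
      intro j
      filter_upwards [e.open_source.mem_nhds hz] with w hw
      have hew : e w = chartAt ℂ k ((chartAt ℂ i).symm w) := rfl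
      simp only [v]
      rw [hew, (chartAt ℂ k).left_inv ((hes w).mp hw).2]
    have hezt : e z ∈ (chartAt ℂ k).target := (chartAt ℂ k).map_source hz2
    have hd : dbar (v i i) z = (starRingEnd ℂ) (deriv e z) * dbar (v i k) (e z) := by
      rw [dbar_congr (heq i), dbar_comp ((hv i k _ hezt).differentiableAt one_ne_zero)
        (han z hz).differentiableAt]
    simp only [F]
    rw [(heq k).self_of_nhds, hd, det_restrictScalars_fderiv, abs_of_nonneg (Complex.normSq_nonneg _)]
    -- At points of `P` both sides vanish with `∂̄ρ_i`. Elsewhere the factor `conj(e')` from `∂̄ρ_i`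
    -- and the factor `e'` from `η` multiply to the Jacobian `|e'|²`.
    by_cases hzP : (chartAt ℂ i).symm z ∈ P
    · obtain ⟨a, ha⟩ := hconst _ hzP i
      have h0 : dbar (v i k) (e z) = 0 := by
        refine dbar_eq_zero_of_eventually_const (c := (a : ℂ)) ?_
        have h1 := hsymm k _ hezt
        rw [hez, (chartAt ℂ k).left_inv hz2] at h1
        filter_upwards [h1.eventually ha] with w hw
        simp only [v, hw]
      simp [h0]
    · rw [hcomp i k z hz1 hz2 hzP, ← hez, Complex.real_smul, ← Complex.mul_conj]
      have : deriv (fun w => chartAt ℂ k ((chartAt ℂ i).symm w)) z = deriv e z := rfl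
      rw [this]
      ring
  -- the total is zero
  have htotal : ∑ i ∈ S, ∫ z in (chartAt ℂ i).target, dbar (v i i) z * η i z = 0 := by
    have h1 : ∀ i ∈ S, ∫ z in (chartAt ℂ i).target, dbar (v i i) z * η i z =
        ∑ k ∈ S, ∫ z in (chartAt ℂ k).target, F k i k z := by
      intro i _
      rw [Finset.sum_congr rfl fun k _ => (hchange i k).symm,
        ← integral_finsetSum _ fun k _ => hInt i i k (Or.inl rfl)]
      refine setIntegral_congr_fun (chartAt ℂ i).open_target.measurableSet fun z _ => ?_
      simp only [F, v]
      rw [← Finset.sum_mul, ← Complex.ofReal_sum, hsum, Complex.ofReal_one, one_mul]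
    -- In the chart at `k`, summing over `i` first produces `∂̄(∑ ρ_i) = ∂̄1 = 0`.
    rw [Finset.sum_congr rfl h1, Finset.sum_comm]
    refine Finset.sum_eq_zero fun k _ => ?_
    rw [← integral_finsetSum _ fun i _ => hInt k i k (Or.inr rfl)]
    rw [← integral_zero ℂ ℂ (μ := volume.restrict (chartAt ℂ k).target)]
    refine setIntegral_congr_fun (chartAt ℂ k).open_target.measurableSet fun z hz => ?_
    simp only [F]
    rw [← Finset.mul_sum, ← Finset.sum_mul,
      ← dbar_sum fun i _ => (hv i k z hz).differentiableAt one_ne_zero,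
      dbar_eq_zero_of_eventually_const (c := 1), zero_mul, mul_zero]
    refine Filter.Eventually.of_forall fun w => ?_
    simp only [v]
    rw [← Complex.ofReal_sum, hsum, Complex.ofReal_one]
  -- each term is a residue
  have hterm : ∀ i ∈ S, ∫ z in (chartAt ℂ i).target, dbar (v i i) z * η i z =
      if i ∈ P then r i * resConst else 0 := by
    intro i _
    set ψ : ℂ → ℂ := fun z => if z ∈ (chartAt ℂ i).target then v i i z else 0 with hψ
    have hψv : ∀ z ∈ (chartAt ℂ i).target, ψ =ᶠ[𝓝 z] v i i := by
      intro z hz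
      filter_upwards [(chartAt ℂ i).open_target.mem_nhds hz] with w hw
      simp only [hψ, if_pos hw]
    have hψsupp : Function.support ψ ⊆ K i := by
      intro z hz
      by_cases hzt : z ∈ (chartAt ℂ i).target
      · refine hmemK i z hzt ?_
        by_contra h
        refine hz ?_
        simp only [hψ, if_pos hzt]
        exact (hnear i i z hzt h).self_of_nhds
      · exact absurd (by simp only [hψ, if_neg hzt]) hz
    have hψt : tsupport ψ ⊆ K i := closure_minimal hψsupp (hK i).isClosed
    have hψc : HasCompactSupport ψ := HasCompactSupport.of_support_subset_isCompact (hK i) hψsupp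
    have hψd : ContDiff ℝ 1 ψ := by
      rw [contDiff_iff_contDiffAt]
      intro z
      by_cases hzt : z ∈ (chartAt ℂ i).target
      · exact (hv i i z hzt).congr_of_eventuallyEq (hψv z hzt)
      · have : z ∉ tsupport ψ := fun h => hzt (hKt i (hψt h))
        exact contDiffAt_const.congr_of_eventuallyEq (notMem_tsupport_iff_eventuallyEq.mp this)
    have hset : ∫ z in (chartAt ℂ i).target, dbar (v i i) z * η i z = ∫ z, dbar ψ z * η i z := by
      have hext : ∫ z in (chartAt ℂ i).target, dbar ψ z * η i z = ∫ z, dbar ψ z * η i z := by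
        refine setIntegral_eq_integral_of_forall_compl_eq_zero fun z hz => ?_
        have : z ∉ tsupport ψ := fun h => hz (hKt i (hψt h))
        rw [dbar_eq_zero_of_eventually_const (notMem_tsupport_iff_eventuallyEq.mp this), zero_mul]
      rw [← hext]
      refine setIntegral_congr_fun (chartAt ℂ i).open_target.measurableSet fun z hz => ?_
      rw [dbar_congr (hψv z hz)]
    have hsuppU : ∀ z ∈ tsupport ψ, z ∈ (chartAt ℂ i).target ∧ (chartAt ℂ i).symm z ∈ U i := by
      intro z hz
      obtain ⟨x, hx, rfl⟩ := hψt hz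
      refine ⟨(chartAt ℂ i).map_source (hsrc i hx), ?_⟩
      rw [(chartAt ℂ i).left_inv (hsrc i hx)]
      exact hρ i hx
    have hnotP : ∀ z ∈ tsupport ψ, (chartAt ℂ i).symm z ≠ i → (chartAt ℂ i).symm z ∉ P := by
      intro z hz hne hP
      exact (hsuppU z hz).2.2 (by simpa [hne] using hP)
    rw [hset]
    split_ifs with hiP
    · obtain ⟨g, hg, hpole⟩ := hres i hiP
      refine integral_dbar_mul_of_simple_pole hψd hψc ?_ ?_ hg hpole
      · have hit := mem_chart_target ℂ i
        have h1 := hsymm i _ hit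
        rw [(chartAt ℂ i).left_inv (mem_chart_source ℂ i)] at h1
        filter_upwards [hψv _ hit, h1.eventually (hone i hiP)] with w hw1 hw2
        rw [hw1]
        simp only [v, hw2, Complex.ofReal_one]
      · intro z hz hzi
        refine hol i z (hsuppU z hz).1 (hnotP z hz fun h => hzi ?_)
        have hinv := (chartAt ℂ i).right_inv (hsuppU z hz).1
        rw [h] at hinv
        exact hinv.symm
    · refine integral_dbar_mul_eq_zero hψd hψc fun z hz => hol i z (hsuppU z hz).1 ?_
      by_cases h : (chartAt ℂ i).symm z = i
      · rwa [h]
      · exact hnotP z hz h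
  rw [Finset.sum_congr rfl hterm, Finset.sum_ite_mem, Finset.inter_eq_right.mpr hPS,
    ← Finset.sum_mul] at htotal
  exact (mul_eq_zero.mp htotal).resolve_right resConst_ne_zero

end ResidueTheorem

/-! ### Meromorphic functions and their divisors. -/

section MeromorphicFunctions

open Filter Set

theorem divDegree_add {X : Type*} (D E : X →₀ ℤ) : divDegree (D + E) = divDegree D + divDegree E :=
  Finsupp.sum_add_index' (fun _ => rfl) fun _ _ _ => rfl

theorem divDegree_single {X : Type*} (q : X) (n : ℤ) : divDegree (Finsupp.single q n) = n :=
  Finsupp.sum_single_index rfl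

theorem finite_of_eventually_notMem {X : Type*} [TopologicalSpace X] [CompactSpace X] (s : Set X)
    (h : ∀ x, ∀ᶠ y in 𝓝[≠] x, y ∉ s) : s.Finite := by
  have h' : ∀ x, {y | y ≠ x → y ∉ s} ∈ 𝓝 x := fun x => eventually_nhdsWithin_iff.mp (h x)
  obtain ⟨t, -, ht⟩ := isCompact_univ.elim_nhds_subcover (fun x : X => {y | y ≠ x → y ∉ s})
    fun x _ => h' x
  refine t.finite_toSet.subset fun y hy => ?_
  obtain ⟨x, hx, hyx⟩ := mem_iUnion₂.mp (ht (mem_univ y))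
  by_contra hyt
  exact hyx (fun h => hyt (h ▸ hx)) hy

variable {X : Type*} [TopologicalSpace X] [ChartedSpace ℂ X]

theorem tendsto_chartAt_punctured (x : X) :
    Tendsto (chartAt ℂ x) (𝓝[≠] x) (𝓝[≠] (chartAt ℂ x x)) := by
  rw [tendsto_nhdsWithin_iff]
  refine ⟨((chartAt ℂ x).continuousAt (mem_chart_source ℂ x)).mono_left nhdsWithin_le_nhds, ?_⟩
  filter_upwards [self_mem_nhdsWithin, mem_nhdsWithin_of_mem_nhds (chart_source_mem_nhds ℂ x)]
    with y hy hys h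
  exact hy ((chartAt ℂ x).injOn hys (mem_chart_source ℂ x) h)

theorem tendsto_chartAt_symm_punctured (x : X) :
    Tendsto (chartAt ℂ x).symm (𝓝[≠] (chartAt ℂ x x)) (𝓝[≠] x) := by
  rw [tendsto_nhdsWithin_iff]
  constructor
  · have h := ((chartAt ℂ x).continuousAt_symm (mem_chart_target ℂ x)).tendsto
    rw [(chartAt ℂ x).left_inv (mem_chart_source ℂ x)] at h
    exact h.mono_left nhdsWithin_le_nhds
  · filter_upwards [self_mem_nhdsWithin, mem_nhdsWithin_of_mem_nhds (chart_target_mem_nhds ℂ x)]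
      with z hz hzt h
    refine hz ?_
    rw [mem_singleton_iff, ← (chartAt ℂ x).right_inv hzt, h]

theorem eventually_punctured_iff (x : X) (q : X → Prop) :
    (∀ᶠ z in 𝓝[≠] (chartAt ℂ x x), q ((chartAt ℂ x).symm z)) ↔ ∀ᶠ y in 𝓝[≠] x, q y := by
  refine ⟨fun h => ?_, fun h => (tendsto_chartAt_symm_punctured x).eventually h⟩
  filter_upwards [(tendsto_chartAt_punctured x).eventually h,
    mem_nhdsWithin_of_mem_nhds (chart_source_mem_nhds ℂ x)] with y hy hys
  rwa [(chartAt ℂ x).left_inv hys] at hy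

theorem ordAt_eq_top_iff {f : X → ℂ} {x : X} :
    ordAt f x = ⊤ ↔ ∀ᶠ y in 𝓝[≠] x, f y = 0 := by
  rw [ordAt, meromorphicOrderAt_eq_top_iff]
  exact eventually_punctured_iff x fun y => f y = 0

theorem eventually_eq_zero_or_ne_zero {f : X → ℂ} {x : X} (hf : MeroAt f x) :
    (∀ᶠ y in 𝓝[≠] x, f y = 0) ∨ ∀ᶠ y in 𝓝[≠] x, f y ≠ 0 := by
  rw [← eventually_punctured_iff x, ← eventually_punctured_iff x (fun y => f y ≠ 0)]
  exact hf.eventually_eq_zero_or_eventually_ne_zero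

theorem nhdsNE_neBot (x : X) : (𝓝[≠] x).NeBot :=
  (tendsto_chartAt_symm_punctured x).neBot

/-- The identity theorem for meromorphic functions. -/
theorem ordAt_eq_top_of_ordAt_eq_top [ConnectedSpace X] [T1Space X] {f : X → ℂ}
    (hf : ∀ x, MeroAt f x) {x₀ : X} (h : ordAt f x₀ = ⊤) (x : X) : ordAt f x = ⊤ := by
  let Z : Set X := {x | ∀ᶠ y in 𝓝[≠] x, f y = 0}
  have hopen : IsOpen Z := by
    rw [isOpen_iff_mem_nhds]
    intro x hx
    have h1 := eventually_eventually_nhdsWithin.mpr hx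
    have h2 : ∀ᶠ y in 𝓝[≠] x, y ∈ Z := by
      have hx' : ∀ᶠ y in 𝓝[≠] x, ∀ᶠ w in 𝓝 y, w ≠ x → f w = 0 := by
        have := eventually_eventually_nhds.mpr (eventually_nhdsWithin_iff.mp hx)
        exact this.filter_mono nhdsWithin_le_nhds
      filter_upwards [hx', self_mem_nhdsWithin] with y hy hyx
      have hne : ∀ᶠ w in 𝓝 y, w ≠ x := isOpen_ne.mem_nhds hyx
      filter_upwards [hy.filter_mono nhdsWithin_le_nhds, hne.filter_mono nhdsWithin_le_nhds]
        with w hw1 hw2 using hw1 hw2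
    rw [eventually_nhdsWithin_iff] at h2
    filter_upwards [h2] with y hy
    by_cases hyx : y = x
    · rwa [hyx]
    · exact hy hyx
  have hclosed : IsClosed Z := by
    rw [← isOpen_compl_iff, isOpen_iff_mem_nhds]
    intro x hx
    have h1 := (eventually_eq_zero_or_ne_zero (hf x)).resolve_left hx
    have hx' := eventually_eventually_nhds.mpr (eventually_nhdsWithin_iff.mp h1)
    filter_upwards [hx'] with y hy hyZ
    by_cases hyx : y = x
    · exact hx (hyx ▸ hyZ)
    · have hne : ∀ᶠ w in 𝓝[≠] y, w ≠ x := mem_nhdsWithin_of_mem_nhds (isOpen_ne.mem_nhds hyx)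
      have := nhdsNE_neBot y
      obtain ⟨w, hw1, hw2, hw3⟩ :=
        ((hy.filter_mono nhdsWithin_le_nhds).and (hne.and hyZ)).exists
      exact hw1 hw2 hw3
  have huniv : Z = univ := IsClopen.eq_univ ⟨hclosed, hopen⟩ ⟨x₀, ordAt_eq_top_iff.mp h⟩
  rw [ordAt_eq_top_iff]
  exact (huniv ▸ mem_univ x : x ∈ Z)

/-- `f` is holomorphic at `y`. -/
def HolAt (f : X → ℂ) (y : X) : Prop := AnalyticAt ℂ (f ∘ (chartAt ℂ y).symm) (chartAt ℂ y y)

theorem HolAt.ordAt_eq_zero {f : X → ℂ} {y : X} (h : HolAt f y) (hne : f y ≠ 0) :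
    ordAt f y = 0 := by
  have h1 : (f ∘ (chartAt ℂ y).symm) (chartAt ℂ y y) ≠ 0 := by
    simpa [(chartAt ℂ y).left_inv (mem_chart_source ℂ y)] using hne
  have h2 : analyticOrderAt (f ∘ (chartAt ℂ y).symm) (chartAt ℂ y y) = 0 :=
    h.analyticOrderAt_eq_zero.mpr h1
  rw [ordAt, AnalyticAt.meromorphicOrderAt_eq h, h2]
  rfl

variable [IsManifold 𝓘(ℂ) ω X]

/-- Whether a function is holomorphic at a point does not depend on the chart. -/
theorem analyticAt_chart_change {f : X → ℂ} {c c' y : X} (hc : y ∈ (chartAt ℂ c).source)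
    (hc' : y ∈ (chartAt ℂ c').source)
    (h : AnalyticAt ℂ (f ∘ (chartAt ℂ c).symm) (chartAt ℂ c y)) :
    AnalyticAt ℂ (f ∘ (chartAt ℂ c').symm) (chartAt ℂ c' y) := by
  have hy : (chartAt ℂ c').symm (chartAt ℂ c' y) = y := (chartAt ℂ c').left_inv hc'
  have hτ : AnalyticAt ℂ (fun w => chartAt ℂ c ((chartAt ℂ c').symm w)) (chartAt ℂ c' y) :=
    analyticAt_transition (chart_mem_atlas ℂ c') (chart_mem_atlas ℂ c)
      ((chartAt ℂ c').map_source hc') (by rwa [hy])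
  have h1 := AnalyticAt.fun_comp (g := f ∘ (chartAt ℂ c).symm)
    (f := fun w => chartAt ℂ c ((chartAt ℂ c').symm w)) (x := chartAt ℂ c' y) (by rwa [hy]) hτ
  refine h1.congr ?_
  have hcont := ((chartAt ℂ c').continuousAt_symm ((chartAt ℂ c').map_source hc')).eventually_mem
    (by rw [hy]; exact (chartAt ℂ c).open_source.mem_nhds hc)
  filter_upwards [hcont] with w hw
  simp only [Function.comp]
  rw [(chartAt ℂ c).left_inv hw]

theorem eventually_holAt {f : X → ℂ} {x : X} (hf : MeroAt f x) : ∀ᶠ y in 𝓝[≠] x, HolAt f y := by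
  filter_upwards [(tendsto_chartAt_punctured x).eventually hf.eventually_analyticAt,
    mem_nhdsWithin_of_mem_nhds (chart_source_mem_nhds ℂ x)] with y hy hys
  exact analyticAt_chart_change hys (mem_chart_source ℂ y) hy

theorem HolAt.analyticAt {f : X → ℂ} {c : X} {z : ℂ} (hz : z ∈ (chartAt ℂ c).target)
    (h : HolAt f ((chartAt ℂ c).symm z)) : AnalyticAt ℂ (f ∘ (chartAt ℂ c).symm) z := by
  have := analyticAt_chart_change (mem_chart_source ℂ _) ((chartAt ℂ c).map_target hz) h
  rwa [(chartAt ℂ c).right_inv hz] at this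

theorem exists_logDeriv_eq {F : ℂ → ℂ} {z₀ : ℂ} {n : ℤ} (hF : MeromorphicAt F z₀)
    (hn : meromorphicOrderAt F z₀ = n) :
    ∃ g : ℂ → ℂ, AnalyticAt ℂ g z₀ ∧ ∀ᶠ z in 𝓝[≠] z₀, logDeriv F z = n / (z - z₀) + g z := by
  obtain ⟨G, hG, hG0, hFG⟩ := (meromorphicOrderAt_eq_int_iff hF).mp hn
  refine ⟨logDeriv G, hG.deriv.div hG hG0, ?_⟩
  have h1 := eventually_eventually_nhds.mpr (eventually_nhdsWithin_iff.mp hFG)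
  filter_upwards [h1.filter_mono nhdsWithin_le_nhds, self_mem_nhdsWithin,
    hG.eventually_analyticAt.filter_mono nhdsWithin_le_nhds,
    (hG.continuousAt.eventually_ne hG0).filter_mono nhdsWithin_le_nhds] with z hz hzz hGz hGz0
  have hsub : z - z₀ ≠ 0 := sub_ne_zero.mpr hzz
  have heq : F =ᶠ[𝓝 z] fun w => (w - z₀) ^ n * G w := by
    filter_upwards [hz, isOpen_ne.mem_nhds hzz] with w hw hw'
    rw [hw hw', smul_eq_mul]
  have hd : DifferentiableAt ℂ (fun w => (w - z₀) ^ n) z :=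
    (differentiableAt_id.sub_const z₀).zpow (Or.inl hsub)
  have hlog : logDeriv F z = logDeriv (fun w => (w - z₀) ^ n * G w) z := by
    rw [logDeriv_apply, logDeriv_apply, heq.deriv_eq, heq.self_of_nhds]
  rw [hlog, logDeriv_mul (f := fun w => (w - z₀) ^ n) z (zpow_ne_zero n hsub) hGz0 hd hGz.differentiableAt]
  congr 1
  rw [logDeriv_fun_zpow (by fun_prop)]
  simp [logDeriv_apply, div_eq_mul_inv]

/-- The degree of the divisor of a meromorphic function is zero. -/
theorem divDegree_eq_zero [T2Space X] [CompactSpace X] {f : X → ℂ} (hf : ∀ x, MeroAt f x)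
    (E : X →₀ ℤ) (hE : ∀ x, ordAt f x = (E x : WithTop ℤ)) : divDegree E = 0 := by
  classical
  -- Besides zeros and poles this catches points where the value of `f` is not its limit; the order,
  -- hence the residue of `df/f`, may be 0 there.
  have hfin : {y : X | ¬ (HolAt f y ∧ f y ≠ 0)}.Finite := by
    refine finite_of_eventually_notMem _ fun x => ?_
    have hne := (eventually_eq_zero_or_ne_zero (hf x)).resolve_left fun h => by
      have := hE x
      rw [ordAt_eq_top_iff.mpr h] at this
      exact WithTop.coe_ne_top this.symm
    filter_upwards [eventually_holAt (hf x), hne] with y hy1 hy2 h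
    exact h ⟨hy1, hy2⟩
  have hP : ∀ y, y ∉ hfin.toFinset → HolAt f y ∧ f y ≠ 0 := by
    intro y hy
    by_contra h
    exact hy (hfin.mem_toFinset.mpr h)
  -- The residue theorem for `df/f`, whose residue at a point is the order of `f`.
  have hsum := sum_residue_eq_zero hfin.toFinset
    (fun c => logDeriv (f ∘ (chartAt ℂ c).symm)) (fun p => (E p : ℂ)) ?_ ?_ ?_
  · rw [divDegree, Finsupp.sum]
    have hsub : E.support ⊆ hfin.toFinset := by
      intro y hy
      by_contra hyP
      have h0 := (hP y hyP).1.ordAt_eq_zero (hP y hyP).2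
      rw [hE y] at h0
      exact (Finsupp.mem_support_iff.mp hy) (by exact_mod_cast h0)
    rw [Finset.sum_subset hsub fun y _ hy => Finsupp.notMem_support_iff.mp hy]
    exact_mod_cast hsum
  · intro c c' z hz hzc' hzP
    have hd : DifferentiableAt ℂ (f ∘ (chartAt ℂ c').symm)
        (chartAt ℂ c' ((chartAt ℂ c).symm z)) := by
      refine (HolAt.analyticAt ((chartAt ℂ c').map_source hzc') ?_).differentiableAt
      rw [(chartAt ℂ c').left_inv hzc']
      exact (hP _ hzP).1
    have hτ := (analyticAt_transition (chart_mem_atlas ℂ c) (chart_mem_atlas ℂ c') hz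
      hzc').differentiableAt
    have heq : f ∘ (chartAt ℂ c).symm =ᶠ[𝓝 z]
        (f ∘ (chartAt ℂ c').symm) ∘ fun w => chartAt ℂ c' ((chartAt ℂ c).symm w) := by
      have hcont := ((chartAt ℂ c).continuousAt_symm hz).eventually_mem
        ((chartAt ℂ c').open_source.mem_nhds hzc')
      filter_upwards [hcont] with w hw
      simp only [Function.comp]
      rw [(chartAt ℂ c').left_inv hw]
    rw [← logDeriv_comp (g := fun w => chartAt ℂ c' ((chartAt ℂ c).symm w)) hd hτ,
      logDeriv_apply, logDeriv_apply, heq.deriv_eq, heq.self_of_nhds]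
  · intro c z hz hzP
    have h := (hP _ hzP).1.analyticAt hz
    exact h.deriv.div h (hP _ hzP).2
  · intro p _
    exact exists_logDeriv_eq (hf p) (hE p)

/-- The divisor of a non-zero meromorphic function. -/
theorem exists_divisor [ConnectedSpace X] [T2Space X] [CompactSpace X] {f : X → ℂ}
    (hf : ∀ x, MeroAt f x) (h0 : f ∉ nullFun X) :
    ∃ E : X →₀ ℤ, ∀ x, ordAt f x = (E x : WithTop ℤ) := by
  have htop : ∀ x, ordAt f x ≠ ⊤ := fun x hx =>
    h0 fun y => ordAt_eq_top_iff.mp (ordAt_eq_top_of_ordAt_eq_top hf hx y)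
  have hfin : {x | (ordAt f x).untop₀ ≠ 0}.Finite := by
    refine finite_of_eventually_notMem _ fun x => ?_
    have hne := (eventually_eq_zero_or_ne_zero (hf x)).resolve_left fun h =>
      htop x (ordAt_eq_top_iff.mpr h)
    filter_upwards [eventually_holAt (hf x), hne] with y hy1 hy2 h
    exact h (by rw [hy1.ordAt_eq_zero hy2]; rfl)
  refine ⟨Finsupp.ofSupportFinite (fun x => (ordAt f x).untop₀) hfin, fun x => ?_⟩
  exact (WithTop.coe_untop₀_of_ne_top (htop x)).symm

/-- A non-zero section `f` would make `(f) + D` an effective divisor of the negative degree `deg D`.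
-/
theorem sectionSpace_le_nullFun [ConnectedSpace X] [T2Space X] [CompactSpace X] {D : X →₀ ℤ}
    (hD : divDegree D < 0) : sectionSpace D ≤ nullFun X := by
  intro f hf
  by_contra h0
  obtain ⟨E, hE⟩ := exists_divisor (fun x => (hf x).1) h0
  have hdeg := divDegree_eq_zero (fun x => (hf x).1) E hE
  have hle : ∀ x, 0 ≤ (E + D) x := by
    intro x
    have h1 := (hf x).2
    rw [hE x] at h1
    have h2 : -(D x) ≤ E x := by exact_mod_cast h1
    rw [Finsupp.add_apply]
    omega
  have hnonneg : 0 ≤ divDegree (E + D) := Finset.sum_nonneg fun x _ => hle x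
  rw [divDegree_add] at hnonneg
  omega

end MeromorphicFunctions

/-! ### Spaces of sections, and non-gaps as dimension jumps. -/

section Sections

open Filter Set Module

theorem sup_span_singleton_eq {K V : Type*} [Field K] [AddCommGroup V] [Module K V]
    {M M' : Submodule K V} (hle : M ≤ M') {g : V} (hg : g ∈ M')
    (h : ∀ f ∈ M', ∃ c : K, f - c • g ∈ M) : M ⊔ Submodule.span K {g} = M' := by
  refine le_antisymm (sup_le hle (by simpa using hg)) fun f hf => ?_
  obtain ⟨c, hc⟩ := h f hf
  rw [← sub_add_cancel f (c • g)]
  exact Submodule.add_mem_sup hc (Submodule.smul_mem _ _ (Submodule.mem_span_singleton_self g))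

theorem finiteDimensional_of_step {K V : Type*} [Field K] [AddCommGroup V] [Module K V]
    {M M' : Submodule K V} [FiniteDimensional K M] (hle : M ≤ M') {g : V} (hg : g ∈ M')
    (h : ∀ f ∈ M', ∃ c : K, f - c • g ∈ M) : FiniteDimensional K M' := by
  rw [← sup_span_singleton_eq hle hg h]
  infer_instance

theorem finrank_of_step {K V : Type*} [Field K] [AddCommGroup V] [Module K V]
    {M M' : Submodule K V} [FiniteDimensional K M] (hle : M ≤ M') {g : V} (hg : g ∈ M')
    (hg' : g ∉ M) (h : ∀ f ∈ M', ∃ c : K, f - c • g ∈ M) : finrank K M' = finrank K M + 1 := by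
  have h1 := Submodule.finrank_sup_add_finrank_inf_eq M (Submodule.span K {g})
  have h0 : g ≠ 0 := fun h => hg' (h ▸ M.zero_mem)
  have hinf : M ⊓ Submodule.span K {g} = ⊥ := by
    rw [← disjoint_iff]
    exact (Submodule.disjoint_span_singleton' h0).mpr hg'
  rw [sup_span_singleton_eq hle hg h, hinf, finrank_bot, finrank_span_singleton h0] at h1
  simpa using h1

/-- A multiple of a function of order `n` cancels the leading term of a function of order at
least `n`. -/
theorem exists_lt_meromorphicOrderAt_sub {F G : ℂ → ℂ} {z₀ : ℂ} {n : ℤ} (hF : MeromorphicAt F z₀)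
    (hG : MeromorphicAt G z₀) (hFn : (n : WithTop ℤ) ≤ meromorphicOrderAt F z₀)
    (hGn : meromorphicOrderAt G z₀ = n) :
    ∃ c : ℂ, (((n + 1 : ℤ)) : WithTop ℤ) ≤ meromorphicOrderAt (F - c • G) z₀ := by
  have hinv : meromorphicOrderAt G⁻¹ z₀ = ((-n : ℤ) : WithTop ℤ) := by
    rw [meromorphicOrderAt_inv, hGn]
    rfl
  have hQ : MeromorphicAt (F * G⁻¹) z₀ := hF.mul hG.inv
  have hQn : 0 ≤ meromorphicOrderAt (F * G⁻¹) z₀ := by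
    rw [meromorphicOrderAt_mul hF hG.inv, hinv]
    refine le_trans ?_ (add_le_add_left hFn _)
    exact_mod_cast (by omega : (0 : ℤ) ≤ n + -n)
  -- `c` is the limit of `F / G` at `z₀`.
  obtain ⟨c, hc⟩ := tendsto_nhds_of_meromorphicOrderAt_nonneg hQ hQn
  refine ⟨c, ?_⟩
  have hR : MeromorphicAt (fun z => (F * G⁻¹) z - c) z₀ := hQ.sub (MeromorphicAt.const c z₀)
  have hRpos : 0 < meromorphicOrderAt (fun z => (F * G⁻¹) z - c) z₀ := by
    rw [← tendsto_zero_iff_meromorphicOrderAt_pos hR]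
    simpa using hc.sub_const c
  have hGne : ∀ᶠ z in 𝓝[≠] z₀, G z ≠ 0 :=
    (meromorphicOrderAt_ne_top_iff_eventually_ne_zero hG).mp (by rw [hGn]; exact WithTop.coe_ne_top)
  have heq : F - c • G =ᶠ[𝓝[≠] z₀] G * fun z => (F * G⁻¹) z - c := by
    filter_upwards [hGne] with z hz
    simp only [Pi.sub_apply, Pi.smul_apply, smul_eq_mul, Pi.mul_apply, Pi.inv_apply]
    field_simp
  rw [meromorphicOrderAt_congr heq, meromorphicOrderAt_mul hG hR, hGn]
  generalize meromorphicOrderAt (fun z => (F * G⁻¹) z - c) z₀ = o at hRpos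
  cases o with
  | top => simp
  | coe o =>
    have : 0 < o := by exact_mod_cast hRpos
    exact_mod_cast (by omega : n + 1 ≤ n + o)

theorem le_add_single {X : Type*} (D : X →₀ ℤ) (q : X) : D ≤ D + Finsupp.single q 1 := by
  classical
  intro x
  rw [Finsupp.add_apply, Finsupp.single_apply]
  split_ifs <;> omega

variable {X : Type*} [TopologicalSpace X] [ChartedSpace ℂ X]

theorem sectionSpace_mono {D D' : X →₀ ℤ} (h : D ≤ D') : sectionSpace D ≤ sectionSpace D' := by
  intro f hf x
  refine ⟨(hf x).1, le_trans ?_ (hf x).2⟩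
  have := h x
  exact_mod_cast (by omega : -(D' x) ≤ -(D x))

theorem nullFun_le_sectionSpace (D : X →₀ ℤ) : nullFun X ≤ sectionSpace D := by
  intro f hf x
  have htop := ordAt_eq_top_iff.mpr (hf x)
  refine ⟨?_, by rw [htop]; exact le_top⟩
  refine MeromorphicAt.congr (MeromorphicAt.const 0 (chartAt ℂ x x)) ?_
  have h := meromorphicOrderAt_eq_top_iff.mp htop
  filter_upwards [h] with z hz using hz.symm

theorem ordAt_eq_of_notMem {D : X →₀ ℤ} {q : X} {f : X → ℂ}
    (hf : f ∈ sectionSpace (D + Finsupp.single q 1)) (hf' : f ∉ sectionSpace D) :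
    ordAt f q = ((-(D q) - 1 : ℤ) : WithTop ℤ) := by
  classical
  by_contra hne
  refine hf' fun x => ⟨(hf x).1, ?_⟩
  have h := (hf x).2
  by_cases hx : x = q
  · subst hx
    rw [Finsupp.add_apply, Finsupp.single_eq_same] at h
    generalize ordAt f x = o at h hne
    cases o with
    | top => exact le_top
    | coe o =>
      have h1 : -(D x + 1) ≤ o := by exact_mod_cast h
      have h2 : o ≠ -(D x) - 1 := fun h => hne (by rw [h])
      exact_mod_cast (by omega : -(D x) ≤ o)
  · rwa [Finsupp.add_apply, Finsupp.single_eq_of_ne hx, add_zero] at h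

theorem mem_sectionSpace_of_le {D : X →₀ ℤ} {q : X} {f : X → ℂ}
    (hf : f ∈ sectionSpace (D + Finsupp.single q 1))
    (h : ((-(D q) : ℤ) : WithTop ℤ) ≤ ordAt f q) : f ∈ sectionSpace D := by
  classical
  intro x
  refine ⟨(hf x).1, ?_⟩
  by_cases hx : x = q
  · rwa [hx]
  · have := (hf x).2
    rwa [Finsupp.add_apply, Finsupp.single_eq_of_ne hx, add_zero] at this

theorem exists_sub_smul_mem_sectionSpace {D : X →₀ ℤ} {q : X} {f g : X → ℂ}
    (hf : f ∈ sectionSpace (D + Finsupp.single q 1))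
    (hg : g ∈ sectionSpace (D + Finsupp.single q 1)) (hg' : g ∉ sectionSpace D) :
    ∃ c : ℂ, f - c • g ∈ sectionSpace D := by
  have hn : ((-(D q) - 1 : ℤ) : WithTop ℤ) ≤ ordAt f q := by
    have := (hf q).2
    rwa [Finsupp.add_apply, Finsupp.single_eq_same, neg_add'] at this
  obtain ⟨c, hc⟩ := exists_lt_meromorphicOrderAt_sub (hf q).1 (hg q).1 hn (ordAt_eq_of_notMem hg hg')
  refine ⟨c, mem_sectionSpace_of_le (Submodule.sub_mem _ hf (Submodule.smul_mem _ c hg)) ?_⟩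
  rwa [sub_add_cancel] at hc

/-- The space of sections of `O(D)`, where functions that agree off a discrete set are
identified. -/
def secQuot (D : X →₀ ℤ) : Submodule ℂ ((X → ℂ) ⧸ nullFun X) :=
  (sectionSpace D).map (nullFun X).mkQ

theorem h0_eq (D : X →₀ ℤ) : h0 D = finrank ℂ (secQuot D) := rfl

theorem mkQ_mem_secQuot {D : X →₀ ℤ} {f : X → ℂ} :
    (nullFun X).mkQ f ∈ secQuot D ↔ f ∈ sectionSpace D := by
  refine ⟨?_, fun h => Submodule.mem_map_of_mem h⟩
  rintro ⟨g, hg, hgf⟩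
  have h1 : f - g ∈ nullFun X := by
    rw [← Submodule.ker_mkQ (nullFun X), LinearMap.mem_ker, map_sub, hgf, sub_self]
  have h2 := Submodule.add_mem _ (nullFun_le_sectionSpace D h1) hg
  rwa [sub_add_cancel] at h2

theorem secQuot_mono {D D' : X →₀ ℤ} (h : D ≤ D') : secQuot D ≤ secQuot D' :=
  Submodule.map_mono (sectionSpace_mono h)

theorem secQuot_step {D : X →₀ ℤ} {q : X} {g : X → ℂ}
    (hg : g ∈ sectionSpace (D + Finsupp.single q 1)) (hg' : g ∉ sectionSpace D) :
    ∀ f ∈ secQuot (D + Finsupp.single q 1),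
      ∃ c : ℂ, f - c • (nullFun X).mkQ g ∈ secQuot D := by
  rintro _ ⟨f, hf, rfl⟩
  obtain ⟨c, hc⟩ := exists_sub_smul_mem_sectionSpace hf hg hg'
  refine ⟨c, ?_⟩
  rw [← map_smul, ← map_sub]
  exact mkQ_mem_secQuot.mpr hc

theorem secQuot_eq_of_forall {D : X →₀ ℤ} {q : X}
    (h : ∀ g ∈ sectionSpace (D + Finsupp.single q 1), g ∈ sectionSpace D) :
    secQuot (D + Finsupp.single q 1) = secQuot D :=
  le_antisymm (Submodule.map_mono h) (secQuot_mono (le_add_single D q))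

/-- Non-gaps are the jumps of the filtration by pole order at `p`. The bound `b` is written as `(b -
1) + 1` to fit the one-point steps. -/
theorem isNonGap_iff {D : X →₀ ℤ} {p : X} {b : ℕ} :
    IsNonGap D p b ↔ ∃ g ∈ sectionSpace (D + Finsupp.single p ((b : ℤ) - 1) + Finsupp.single p 1),
      g ∉ sectionSpace (D + Finsupp.single p ((b : ℤ) - 1)) := by
  classical
  have hadd : ∀ (o : WithTop ℤ) (d : ℤ), 0 ≤ o + (d : WithTop ℤ) ↔ ((-d : ℤ) : WithTop ℤ) ≤ o := by
    intro o d
    cases o with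
    | top => simp
    | coe o =>
      have : (0 : ℤ) ≤ o + d ↔ -d ≤ o := by omega
      exact_mod_cast this
  have hp : ∀ (o : WithTop ℤ) (d : ℤ), o + (d : WithTop ℤ) = ((-(b : ℤ) : ℤ) : WithTop ℤ) ↔
      o = ((-(b : ℤ) - d : ℤ) : WithTop ℤ) := by
    intro o d
    cases o with
    | top =>
      exact iff_of_false (by rw [WithTop.top_add]; exact WithTop.coe_ne_top.symm)
        WithTop.coe_ne_top.symm
    | coe o =>
      have : o + d = -(b : ℤ) ↔ o = -(b : ℤ) - d := by omega
      exact_mod_cast this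
  constructor
  · rintro ⟨f, hf, hoff, hfp⟩
    rw [hp] at hfp
    refine ⟨f, fun x => ⟨hf x, ?_⟩, fun hmem => ?_⟩
    · by_cases hx : x = p
      · subst hx
        rw [hfp]
        simp only [Finsupp.add_apply, Finsupp.single_eq_same]
        exact_mod_cast (by omega : -(D x + ((b : ℤ) - 1) + 1) ≤ -(b : ℤ) - D x)
      · have := (hadd _ _).mp (hoff x hx)
        simpa only [Finsupp.add_apply, Finsupp.single_eq_of_ne hx, add_zero] using this
    · have := (hmem p).2
      rw [hfp] at this
      simp only [Finsupp.add_apply, Finsupp.single_eq_same] at this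
      have h' : -(D p + ((b : ℤ) - 1)) ≤ -(b : ℤ) - D p := by exact_mod_cast this
      omega
  · rintro ⟨g, hg, hg'⟩
    refine ⟨g, fun x => (hg x).1, fun x hx => ?_, ?_⟩
    · rw [hadd]
      have := (hg x).2
      simpa only [Finsupp.add_apply, Finsupp.single_eq_of_ne hx, add_zero] using this
    · rw [hp, ordAt_eq_of_notMem hg hg']
      simp only [Finsupp.add_apply, Finsupp.single_eq_same]
      congr 1
      ring

variable [IsManifold 𝓘(ℂ) ω X] [T2Space X] [CompactSpace X] [ConnectedSpace X]

theorem secQuot_eq_bot {D : X →₀ ℤ} (hD : divDegree D < 0) : secQuot D = ⊥ := by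
  rw [eq_bot_iff]
  rintro _ ⟨f, hf, rfl⟩
  exact (Submodule.Quotient.mk_eq_zero _).mpr (sectionSpace_le_nullFun hD hf)

open Classical in
/-- For a divisor `D` of degree zero, `h⁰(D + (N - 1) p)` is the number of non-gaps below `N`. -/
theorem finrank_secQuot_eq_count {D : X →₀ ℤ} (hD : divDegree D = 0) (p : X) (N : ℕ) :
    FiniteDimensional ℂ (secQuot (D + Finsupp.single p ((N : ℤ) - 1))) ∧
      finrank ℂ (secQuot (D + Finsupp.single p ((N : ℤ) - 1))) = Nat.count (IsNonGap D p) N := by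
  induction N with
  | zero =>
    rw [secQuot_eq_bot (by rw [divDegree_add, divDegree_single, hD]; simp)]
    exact ⟨inferInstance, by simp⟩
  | succ N ih =>
    obtain ⟨ih1, ih2⟩ := ih
    have hstep : D + Finsupp.single p (((N + 1 : ℕ) : ℤ) - 1) =
        D + Finsupp.single p ((N : ℤ) - 1) + Finsupp.single p 1 := by
      rw [add_assoc, ← Finsupp.single_add]
      congr 2
      push_cast
      ring
    rw [hstep, Nat.count_succ]
    by_cases h : IsNonGap D p N
    · obtain ⟨g, hg, hg'⟩ := isNonGap_iff.mp h
      rw [if_pos h, ← ih2]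
      exact ⟨finiteDimensional_of_step (secQuot_mono (le_add_single _ p)) (mkQ_mem_secQuot.mpr hg)
          (secQuot_step hg hg'),
        finrank_of_step (secQuot_mono (le_add_single _ p)) (mkQ_mem_secQuot.mpr hg)
          (fun h => hg' (mkQ_mem_secQuot.mp h)) (secQuot_step hg hg')⟩
    · have hall : ∀ g ∈ sectionSpace (D + Finsupp.single p ((N : ℤ) - 1) + Finsupp.single p 1),
          g ∈ sectionSpace (D + Finsupp.single p ((N : ℤ) - 1)) := by
        intro g hg
        by_contra hg'
        exact h (isNonGap_iff.mpr ⟨g, hg, hg'⟩)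
      rw [secQuot_eq_of_forall hall, if_neg h, add_zero]
      exact ⟨ih1, ih2⟩

open Classical in
-- The only property of `m_k` that the combinatorics uses.
theorem mult_eq_count {D : X →₀ ℤ} (hD : divDegree D = 0) (p : X) {k : ℕ} (hk : k ≤ genus X) :
    mult D p k = Nat.count (IsNonGap D p) (genus X - k) := by
  have h : (genus X : ℤ) - 1 - k = ((genus X - k : ℕ) : ℤ) - 1 := by omega
  rw [← (finrank_secQuot_eq_count hD p (genus X - k)).2, mult, h0_eq, h]

end Sections

/-! ### Holomorphic one-forms and the Riemann–Roch inequality. -/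

section HolomorphicForms

open Filter Set Module

variable {X : Type*} [TopologicalSpace X] [ChartedSpace ℂ X] [IsManifold 𝓘(ℂ) ω X]

/-- The one-form `s` at the point `x`, as a linear map on the model space. -/
def formAt (s : HolOneForm X) (x : X) : ℂ →L[ℂ] ℂ := s x

/-- The coefficient of `dz` in the expression of a one-form in the chart around `c`. -/
def formLoc (s : HolOneForm X) (c : X) (z : ℂ) : ℂ :=
  formAt s ((chartAt ℂ c).symm z)
    (tangentCoordChange 𝓘(ℂ) c ((chartAt ℂ c).symm z) ((chartAt ℂ c).symm z) 1)

theorem formLoc_add (s t : HolOneForm X) (c : X) : formLoc (s + t) c = formLoc s c + formLoc t c :=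
  rfl

theorem formLoc_zero (c : X) : formLoc (0 : HolOneForm X) c = 0 := rfl

theorem tangentCoordChange_one {c c' : X} {z : ℂ} (hz : z ∈ (chartAt ℂ c).target) :
    tangentCoordChange 𝓘(ℂ) c c' ((chartAt ℂ c).symm z) 1 =
      deriv (fun w => chartAt ℂ c' ((chartAt ℂ c).symm w)) z := by
  rw [tangentCoordChange_def, ← fderiv_apply_one_eq_deriv]
  simp only [extChartAt, mfld_simps]
  rw [(chartAt ℂ c).right_inv hz, fderivWithin_univ]
  rfl

/-- The transformation law that `sum_residue_eq_zero` asks for; it comes from the cocycle identity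
of the tangent coordinate changes. -/
theorem formLoc_eq_mul (s : HolOneForm X) {c c' : X} {z : ℂ} (hz : z ∈ (chartAt ℂ c).target)
    (hz' : (chartAt ℂ c).symm z ∈ (chartAt ℂ c').source) :
    formLoc s c z = formLoc s c' (chartAt ℂ c' ((chartAt ℂ c).symm z)) *
      deriv (fun w => chartAt ℂ c' ((chartAt ℂ c).symm w)) z := by
  rw [formLoc, formLoc, (chartAt ℂ c').left_inv hz', ← tangentCoordChange_one hz]
  set x := (chartAt ℂ c).symm z
  have hcomp := tangentCoordChange_comp (I := 𝓘(ℂ)) (w := c) (x := c') (y := x) (z := x)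
    (v := (1 : ℂ)) (by
      simp only [extChartAt_source]
      exact ⟨⟨(chartAt ℂ c).map_target hz, hz'⟩, mem_chart_source ℂ x⟩)
  rw [← hcomp]
  set a : ℂ := tangentCoordChange 𝓘(ℂ) c c' x 1
  have hlin : ∀ L : ℂ →L[ℂ] ℂ, L a = L 1 * a := by
    intro L
    have := L.map_smul a 1
    rw [smul_eq_mul, mul_one, smul_eq_mul] at this
    rw [this, mul_comm]
  exact hlin ((formAt s x).comp (tangentCoordChange 𝓘(ℂ) c' x x))

theorem analyticAt_formLoc_self (s : HolOneForm X) (c : X) :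
    AnalyticAt ℂ (formLoc s c) (chartAt ℂ c c) := by
  have h1 := ((contMDiffAt_hom_bundle _).mp (s.contMDiff c)).2
  have h2 : ContMDiffAt 𝓘(ℂ) 𝓘(ℂ) ω (fun x : X => formLoc s c (chartAt ℂ c x)) c := by
    have h3 := h1.clm_apply (contMDiffAt_const (c := (1 : ℂ)))
    refine h3.congr_of_eventuallyEq ?_
    filter_upwards [chart_source_mem_nhds ℂ c] with x hx
    rw [formLoc, (chartAt ℂ c).left_inv hx]
    simp only [ContinuousLinearMap.inCoordinates]
    rw [TangentBundle.symmL_trivializationAt_eq_core hx]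
    simp
    rfl
  have h4 := (contMDiffAt_iff.mp h2).2
  simp only [extChartAt, mfld_simps] at h4
  rw [contDiffWithinAt_univ] at h4
  refine h4.analyticAt.congr ?_
  filter_upwards [chart_target_mem_nhds ℂ c] with z hz
  simp only [Function.comp, chartAt_self_eq, OpenPartialHomeomorph.refl_apply]
  rw [(chartAt ℂ c).right_inv hz]
  rfl

/-- `analyticAt_formLoc_self` covers only the centre of a chart; other points are reached by passing
to the chart around them. -/
theorem analyticAt_formLoc (s : HolOneForm X) {c : X} {z : ℂ} (hz : z ∈ (chartAt ℂ c).target) :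
    AnalyticAt ℂ (formLoc s c) z := by
  set y := (chartAt ℂ c).symm z with hy
  have hτ : AnalyticAt ℂ (fun w => chartAt ℂ y ((chartAt ℂ c).symm w)) z :=
    analyticAt_transition (chart_mem_atlas ℂ c) (chart_mem_atlas ℂ y) hz (mem_chart_source ℂ y)
  have h1 := (AnalyticAt.fun_comp (g := formLoc s y)
    (f := fun w => chartAt ℂ y ((chartAt ℂ c).symm w)) (x := z)
    (analyticAt_formLoc_self s y) hτ).mul hτ.deriv
  refine h1.congr ?_
  have hcont := ((chartAt ℂ c).continuousAt_symm hz).eventually_mem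
    ((chartAt ℂ y).open_source.mem_nhds (mem_chart_source ℂ y))
  filter_upwards [hcont, (chartAt ℂ c).open_target.mem_nhds hz] with w hw hwt
  exact (formLoc_eq_mul s hwt hw).symm

theorem formLoc_eq_zero_iff (s : HolOneForm X) {c y : X} (hy : y ∈ (chartAt ℂ c).source) :
    formLoc s c (chartAt ℂ c y) = 0 ↔ formAt s y = 0 := by
  rw [formLoc, (chartAt ℂ c).left_inv hy]
  refine ⟨fun h => ?_, fun h => by rw [h]; rfl⟩
  have hinv := tangentCoordChange_comp (I := 𝓘(ℂ)) (w := c) (x := y) (y := c) (z := y)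
    (v := (1 : ℂ)) (by
      simp only [extChartAt_source]
      exact ⟨⟨hy, mem_chart_source ℂ y⟩, hy⟩)
  rw [tangentCoordChange_self (by simpa only [extChartAt_source] using hy)] at hinv
  set a : ℂ := tangentCoordChange 𝓘(ℂ) c y y 1
  have ha : a ≠ 0 := by
    intro ha
    rw [ha, map_zero] at hinv
    exact zero_ne_one hinv
  ext
  have h1 := (formAt s y).map_smul a 1
  rw [smul_eq_mul, mul_one, h, smul_eq_mul] at h1
  simpa using (mul_eq_zero.mp h1.symm).resolve_left ha

/-- The identity theorem for holomorphic one-forms. -/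
theorem eq_zero_of_formLoc_eventually_eq_zero [ConnectedSpace X] (s : HolOneForm X) {p : X}
    (h : ∀ᶠ z in 𝓝 (chartAt ℂ p p), formLoc s p z = 0) : s = 0 := by
  let Z : Set X := {x | ∀ᶠ y in 𝓝 x, formAt s y = 0}
  have hlocal : ∀ x, (∀ᶠ z in 𝓝 (chartAt ℂ x x), formLoc s x z = 0) → x ∈ Z := by
    intro x hx
    have h1 := ((chartAt ℂ x).continuousAt (mem_chart_source ℂ x)).eventually hx
    filter_upwards [h1, chart_source_mem_nhds ℂ x] with y hy hys
    exact (formLoc_eq_zero_iff s hys).mp hy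
  have hopen : IsOpen Z := by
    rw [isOpen_iff_mem_nhds]
    exact fun x hx => eventually_eventually_nhds.mpr hx
  have hclosed : IsClosed Z := by
    rw [← isOpen_compl_iff, isOpen_iff_mem_nhds]
    intro x hx
    rcases (analyticAt_formLoc_self s x).eventually_eq_zero_or_eventually_ne_zero with h1 | h1
    · exact absurd (hlocal x h1) hx
    · have h2 := eventually_nhdsWithin_iff.mp ((tendsto_chartAt_punctured x).eventually h1)
      filter_upwards [h2, chart_source_mem_nhds ℂ x] with y hy hys hyZ
      by_cases hyx : y = x
      · exact hx (hyx ▸ hyZ)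
      · exact hy hyx ((formLoc_eq_zero_iff s hys).mpr hyZ.self_of_nhds)
  have huniv : Z = univ := IsClopen.eq_univ ⟨hclosed, hopen⟩ ⟨p, hlocal p h⟩
  ext1 x
  have hx : x ∈ Z := huniv ▸ mem_univ x
  exact hx.self_of_nhds

/-- The order of vanishing of a holomorphic one-form. -/
def formOrd (s : HolOneForm X) (x : X) : WithTop ℤ :=
  meromorphicOrderAt (formLoc s x) (chartAt ℂ x x)

theorem meromorphicAt_formLoc (s : HolOneForm X) (x : X) :
    MeromorphicAt (formLoc s x) (chartAt ℂ x x) :=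
  (analyticAt_formLoc_self s x).meromorphicAt

theorem formOrd_nonneg (s : HolOneForm X) (x : X) : 0 ≤ formOrd s x :=
  (analyticAt_formLoc_self s x).meromorphicOrderAt_nonneg

/-- The holomorphic one-forms `s` with `(s) ≥ E`. -/
def formSpace (E : X →₀ ℤ) : Submodule ℂ (HolOneForm X) where
  carrier := {s | ∀ x, ((E x : ℤ) : WithTop ℤ) ≤ formOrd s x}
  zero_mem' := by
    intro x
    have : formOrd (0 : HolOneForm X) x = ⊤ := by
      rw [formOrd, formLoc_zero, meromorphicOrderAt_eq_top_iff]
      exact Eventually.of_forall fun _ => rfl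
    rw [this]
    exact le_top
  add_mem' := by
    intro s t hs ht x
    rw [formOrd, formLoc_add]
    exact le_trans (le_min (hs x) (ht x))
      (meromorphicOrderAt_add (meromorphicAt_formLoc s x) (meromorphicAt_formLoc t x))
  smul_mem' := by
    intro c s hs x
    have hc : MeromorphicAt (fun _ : ℂ => c) (chartAt ℂ x x) := MeromorphicAt.const c _
    have h1 : formOrd (c • s) x
        = meromorphicOrderAt (fun _ : ℂ => c) (chartAt ℂ x x) + formOrd s x :=
      meromorphicOrderAt_smul hc (meromorphicAt_formLoc s x)
    have h2 : 0 ≤ meromorphicOrderAt (fun _ : ℂ => c) (chartAt ℂ x x) :=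
      analyticAt_const.meromorphicOrderAt_nonneg
    rw [h1]
    exact le_trans (hs x) (le_add_of_nonneg_left h2)

theorem formSpace_anti {E E' : X →₀ ℤ} (h : E ≤ E') : formSpace E' ≤ formSpace E :=
  fun _ hs x => le_trans (by exact_mod_cast h x) (hs x)

theorem formSpace_zero : formSpace (0 : X →₀ ℤ) = ⊤ :=
  eq_top_iff.mpr fun s _ x => formOrd_nonneg s x

theorem mem_formSpace_of_le {E : X →₀ ℤ} {q : X} {s : HolOneForm X} (hs : s ∈ formSpace E)
    (h : ((E q + 1 : ℤ) : WithTop ℤ) ≤ formOrd s q) : s ∈ formSpace (E + Finsupp.single q 1) := by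
  classical
  intro x
  by_cases hx : x = q
  · subst hx
    rwa [Finsupp.add_apply, Finsupp.single_eq_same]
  · rw [Finsupp.add_apply, Finsupp.single_eq_of_ne hx, add_zero]
    exact hs x

theorem formOrd_eq_of_notMem {E : X →₀ ℤ} {q : X} {s : HolOneForm X} (hs : s ∈ formSpace E)
    (hs' : s ∉ formSpace (E + Finsupp.single q 1)) : formOrd s q = ((E q : ℤ) : WithTop ℤ) := by
  by_contra hne
  refine hs' (mem_formSpace_of_le hs ?_)
  have h := hs q
  generalize formOrd s q = o at h hne
  cases o with
  | top => exact le_top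
  | coe o =>
    have h1 : E q ≤ o := by exact_mod_cast h
    have h2 : o ≠ E q := fun h => hne (by rw [h])
    exact_mod_cast (by omega : E q + 1 ≤ o)

theorem exists_sub_smul_mem_formSpace {E : X →₀ ℤ} {q : X} {s t : HolOneForm X}
    (hs : s ∈ formSpace E) (ht : t ∈ formSpace E)
    (ht' : t ∉ formSpace (E + Finsupp.single q 1)) :
    ∃ c : ℂ, s - c • t ∈ formSpace (E + Finsupp.single q 1) := by
  obtain ⟨c, hc⟩ := exists_lt_meromorphicOrderAt_sub (meromorphicAt_formLoc s q)
    (meromorphicAt_formLoc t q) (hs q) (formOrd_eq_of_notMem ht ht')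
  exact ⟨c, mem_formSpace_of_le (Submodule.sub_mem _ hs (Submodule.smul_mem _ c ht)) hc⟩

theorem exists_simple_pole {F : ℂ → ℂ} {z₀ : ℂ} (hF : MeromorphicAt F z₀)
    (h : meromorphicOrderAt F z₀ = ((-1 : ℤ) : WithTop ℤ)) :
    ∃ a : ℂ, a ≠ 0 ∧ ∃ g : ℂ → ℂ, AnalyticAt ℂ g z₀ ∧
      ∀ᶠ z in 𝓝[≠] z₀, F z = a / (z - z₀) + g z := by
  obtain ⟨G, hG, hG0, hFG⟩ := (meromorphicOrderAt_eq_int_iff hF).mp h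
  have hd : MeromorphicAt (fun z => (z - z₀)⁻¹ * (G z - G z₀)) z₀ := by
    have := hG.meromorphicAt
    fun_prop
  have hnonneg : 0 ≤ meromorphicOrderAt (fun z => (z - z₀)⁻¹ * (G z - G z₀)) z₀ := by
    rw [← tendsto_nhds_iff_meromorphicOrderAt_nonneg hd]
    exact ⟨deriv G z₀, hasDerivAt_iff_tendsto_slope.mp hG.differentiableAt.hasDerivAt⟩
  obtain ⟨g, hg, hgeq⟩ := hd.meromorphicOrderAt_nonneg_iff.mp hnonneg
  refine ⟨G z₀, hG0, g, hg, ?_⟩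
  filter_upwards [hFG, hgeq, self_mem_nhdsWithin] with z hz1 hz2 hz3
  have hz : z - z₀ ≠ 0 := sub_ne_zero.mpr hz3
  rw [hz1, ← hz2, zpow_neg_one, smul_eq_mul]
  field_simp
  ring

/-- The decreasing chain of these spaces stabilizes by finite dimension, and a form in the stable
term vanishes to infinite order at `p`. -/
theorem exists_formSpace_single_eq_bot [ConnectedSpace X] [FiniteDimensional ℂ (HolOneForm X)] (p : X) :
    ∃ N : ℕ, formSpace (Finsupp.single p (N : ℤ)) = ⊥ := by
  classical
  have hmono : ∀ m n : ℕ, m ≤ n → formSpace (Finsupp.single p (n : ℤ)) ≤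
      formSpace (X := X) (Finsupp.single p (m : ℤ)) := fun m n hmn =>
    formSpace_anti (Finsupp.single_mono (by exact_mod_cast hmn))
  obtain ⟨N, hN⟩ := IsArtinian.monotone_stabilizes (R := ℂ) (M := HolOneForm X)
    ⟨fun n : ℕ => OrderDual.toDual (formSpace (Finsupp.single p (n : ℤ))),
      fun m n hmn => hmono m n hmn⟩
  refine ⟨N, eq_bot_iff.mpr fun s hs => ?_⟩
  have hall : ∀ m : ℕ, ((m : ℤ) : WithTop ℤ) ≤ formOrd s p := by
    intro m
    have hmem : s ∈ formSpace (Finsupp.single p ((max N m : ℕ) : ℤ)) := by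
      have h := hN (max N m) (le_max_left _ _)
      have h' : formSpace (Finsupp.single p (N : ℤ)) =
        formSpace (X := X) (Finsupp.single p ((max N m : ℕ) : ℤ)) := h
      rwa [← h']
    have h1 := hmem p
    rw [Finsupp.single_eq_same] at h1
    refine le_trans ?_ h1
    exact_mod_cast le_max_right N m
  have htop : formOrd s p = ⊤ := by
    generalize formOrd s p = o at hall
    cases o with
    | top => rfl
    | coe o =>
      have h := hall (o.toNat + 1)
      have h' : ((o.toNat + 1 : ℕ) : ℤ) ≤ o := by exact_mod_cast h
      omega
  rw [Submodule.mem_bot]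
  refine eq_zero_of_formLoc_eventually_eq_zero s (p := p) ?_
  rcases (analyticAt_formLoc_self s p).eventually_eq_zero_or_eventually_ne_zero with h | h
  · exact h
  · obtain ⟨z, hz1, hz2⟩ := (h.and (meromorphicOrderAt_eq_top_iff.mp htop)).exists
    exact absurd hz2 hz1

variable [T2Space X] [CompactSpace X]

/-- A function with a pole of order `E q + 1` and a form with a zero of order `E q` at `q` would
give a form with a single simple pole. -/
theorem mem_formSpace_add_single {E : X →₀ ℤ} {q : X} {f : X → ℂ}
    (hf : f ∈ sectionSpace (E + Finsupp.single q 1)) (hf' : f ∉ sectionSpace E)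
    {s : HolOneForm X} (hs : s ∈ formSpace E) : s ∈ formSpace (E + Finsupp.single q 1) := by
  classical
  by_contra hs'
  have hfin : {y : X | ¬ HolAt f y}.Finite := by
    refine finite_of_eventually_notMem _ fun x => ?_
    filter_upwards [eventually_holAt (hf x).1] with y hy h using h hy
  let P : Finset X := insert q hfin.toFinset
  have hP : ∀ y, y ∉ P → HolAt f y := by
    intro y hy
    by_contra h
    exact hy (Finset.mem_insert_of_mem (hfin.mem_toFinset.mpr h))
  let η : X → ℂ → ℂ := fun c z => f ((chartAt ℂ c).symm z) * formLoc s c z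
  have hηm : ∀ x, MeromorphicAt (η x) (chartAt ℂ x x) := fun x =>
    (hf x).1.mul (meromorphicAt_formLoc s x)
  have hηo : ∀ x, meromorphicOrderAt (η x) (chartAt ℂ x x) = ordAt f x + formOrd s x := fun x =>
    meromorphicOrderAt_mul (hf x).1 (meromorphicAt_formLoc s x)
  obtain ⟨a, ha, hpole⟩ := exists_simple_pole (hηm q) (by
    rw [hηo, ordAt_eq_of_notMem hf hf', formOrd_eq_of_notMem hs hs', ← WithTop.coe_add]
    congr 1
    ring)
  have hsum := sum_residue_eq_zero P η (fun x => if x = q then a else 0) ?_ ?_ ?_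
  · rw [Finset.sum_ite_eq', if_pos (Finset.mem_insert_self _ _)] at hsum
    exact ha hsum
  · intro c c' z hz hzc' _
    simp only [η]
    rw [formLoc_eq_mul s hz hzc', (chartAt ℂ c').left_inv hzc', mul_assoc]
  · intro c z hz hzP
    exact ((hP _ hzP).analyticAt hz).mul (analyticAt_formLoc s hz)
  · intro x _
    by_cases hx : x = q
    · subst hx
      simpa only [if_pos] using hpole
    · have hnonneg : 0 ≤ meromorphicOrderAt (η x) (chartAt ℂ x x) := by
        rw [hηo]
        have h1 := (hf x).2
        rw [Finsupp.add_apply, Finsupp.single_eq_of_ne hx, add_zero] at h1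
        refine le_trans ?_ (add_le_add h1 (hs x))
        exact_mod_cast (by omega : (0 : ℤ) ≤ -(E x) + E x)
      obtain ⟨g, hg, hgeq⟩ := (hηm x).meromorphicOrderAt_nonneg_iff.mp hnonneg
      refine ⟨g, hg, ?_⟩
      filter_upwards [hgeq] with z hz
      rw [if_neg hx, zero_div, zero_add, hz]

variable [ConnectedSpace X]

/-- The part of the Riemann–Roch theorem that follows from the residue theorem, for effective
divisors. -/
theorem h0_add_genus_le [FiniteDimensional ℂ (HolOneForm X)] [Nonempty X] (n : ℕ) (E : X →₀ ℤ)
    (hE : 0 ≤ E) (hn : divDegree E = n) :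
    FiniteDimensional ℂ (secQuot E) ∧
      h0 E + genus X ≤ n + 1 + finrank ℂ (formSpace E) := by
  classical
  induction n generalizing E with
  | zero =>
    have hE0 : E = 0 := by
      ext x
      by_contra hx
      have hpos : 0 < divDegree E :=
        Finset.sum_pos' (fun y _ => hE y) ⟨x, Finsupp.mem_support_iff.mpr hx,
          lt_of_le_of_ne (hE x) (Ne.symm hx)⟩
      rw [hn] at hpos
      exact lt_irrefl _ hpos
    subst hE0
    obtain ⟨p⟩ := ‹Nonempty X›
    -- `h⁰(0)` counts the non-gaps of the trivial bundle below 1, hence is at most 1.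
    have hc := finrank_secQuot_eq_count (D := (0 : X →₀ ℤ)) rfl p 1
    rw [Nat.cast_one, sub_self, Finsupp.single_zero, add_zero] at hc
    refine ⟨hc.1, ?_⟩
    have hcount : Nat.count (IsNonGap (0 : X →₀ ℤ) p) 1 ≤ 1 := Nat.count_le _
    rw [h0_eq, hc.2, formSpace_zero, finrank_top, genus]
    omega
  | succ n ih =>
    obtain ⟨q, hq⟩ : ∃ q, 0 < E q := by
      by_contra hcon
      push Not at hcon
      have : divDegree E ≤ 0 := Finset.sum_nonpos fun x _ => hcon x
      rw [hn] at this
      push_cast at this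
      omega
    obtain ⟨E', rfl⟩ : ∃ E', E = E' + Finsupp.single q 1 :=
      ⟨E - Finsupp.single q 1, by rw [sub_add_cancel]⟩
    have hE' : 0 ≤ E' := by
      intro x
      have h1 := hE x
      rw [Finsupp.add_apply] at h1
      by_cases hx : x = q
      · subst hx
        rw [Finsupp.add_apply, Finsupp.single_eq_same] at hq
        simp only [Finsupp.coe_zero, Pi.zero_apply]
        omega
      · rwa [Finsupp.single_eq_of_ne hx, add_zero] at h1
    obtain ⟨ih1, ih2⟩ := ih E' hE' (by
      rw [divDegree_add, divDegree_single] at hn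
      push_cast at hn
      omega)
    -- Either `h⁰` grows by one and the space of forms stays the same, or `h⁰` stays the same and
    -- the space of forms loses at most one dimension.
    by_cases h : ∃ f ∈ sectionSpace (E' + Finsupp.single q 1), f ∉ sectionSpace E'
    · obtain ⟨f, hf, hf'⟩ := h
      have hform : formSpace (E' + Finsupp.single q 1) = formSpace E' :=
        le_antisymm (formSpace_anti (le_add_single E' q))
          fun s hs => mem_formSpace_add_single hf hf' hs
      have hle := secQuot_mono (le_add_single E' q)
      refine ⟨finiteDimensional_of_step hle (mkQ_mem_secQuot.mpr hf) (secQuot_step hf hf'), ?_⟩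
      rw [h0_eq, finrank_of_step hle (mkQ_mem_secQuot.mpr hf)
        (fun h => hf' (mkQ_mem_secQuot.mp h)) (secQuot_step hf hf'), hform, ← h0_eq]
      omega
    · push Not at h
      have hform : finrank ℂ (formSpace E') ≤
          finrank ℂ (formSpace (E' + Finsupp.single q 1)) + 1 := by
        by_cases ht : ∃ t ∈ formSpace E', t ∉ formSpace (E' + Finsupp.single q 1)
        · obtain ⟨t, ht, ht'⟩ := ht
          exact (finrank_of_step (formSpace_anti (le_add_single E' q)) ht ht'
            fun s hs => exists_sub_smul_mem_formSpace hs ht ht').le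
        · push Not at ht
          have heq : formSpace E' = formSpace (E' + Finsupp.single q 1) :=
            le_antisymm ht (formSpace_anti (le_add_single E' q))
          rw [heq]
          omega
      rw [h0_eq, secQuot_eq_of_forall h, ← h0_eq]
      exact ⟨ih1, by omega⟩

end HolomorphicForms

/-! ### Existence of `g` gaps and the gap partition. -/

section Gaps

open Filter Set Module

theorem count_add_count_of_iff_not {q r : ℕ → Prop} [DecidablePred q] [DecidablePred r]
    (h : ∀ b, r b ↔ ¬ q b) (N : ℕ) : Nat.count r N + Nat.count q N = N := by
  induction N with
  | zero => simp
  | succ N ih =>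
    rw [Nat.count_succ, Nat.count_succ]
    by_cases hq : q N <;> simp [h, hq] <;> omega

variable {X : Type*} [TopologicalSpace X]

/-- Multiplication by a function, on functions modulo functions that vanish off a discrete
set. -/
def mulQuot (h : X → ℂ) : ((X → ℂ) ⧸ nullFun X) →ₗ[ℂ] ((X → ℂ) ⧸ nullFun X) :=
  (nullFun X).mapQ (nullFun X) (LinearMap.mulLeft ℂ h) (by
    intro f hf x
    filter_upwards [hf x] with y hy
    simp [hy])

theorem mulQuot_mkQ (h f : X → ℂ) :
    mulQuot h ((nullFun X).mkQ f) = (nullFun X).mkQ (h * f) := rfl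

theorem mulQuot_injective {h : X → ℂ} (hne : ∀ x, ∀ᶠ y in 𝓝[≠] x, h y ≠ 0) :
    Function.Injective (mulQuot h) := by
  rw [← LinearMap.ker_eq_bot, LinearMap.ker_eq_bot']
  intro v hv
  obtain ⟨f, rfl⟩ := Submodule.mkQ_surjective _ v
  rw [mulQuot_mkQ] at hv
  have hmem : h * f ∈ nullFun X := (Submodule.Quotient.mk_eq_zero _).mp hv
  refine (Submodule.Quotient.mk_eq_zero _).mpr fun x => ?_
  filter_upwards [hmem x, hne x] with y hy1 hy2
  exact (mul_eq_zero.mp hy1).resolve_left hy2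

variable [ChartedSpace ℂ X]

/-- Linearly equivalent divisors: division by a function `f₀` with divisor `E` maps the sections
of `O(D)` into those of `O(D + E)`. -/
theorem h0_le_h0_add {f₀ : X → ℂ} (hf₀ : ∀ x, MeroAt f₀ x) (D E : X →₀ ℤ)
    (hE : ∀ x, ordAt f₀ x = (E x : WithTop ℤ)) [FiniteDimensional ℂ (secQuot (D + E))] :
    h0 D ≤ h0 (D + E) := by
  have hne : ∀ x, ∀ᶠ y in 𝓝[≠] x, (f₀⁻¹) y ≠ 0 := by
    intro x
    have h := (eventually_eq_zero_or_ne_zero (hf₀ x)).resolve_left fun h => by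
      have := hE x
      rw [ordAt_eq_top_iff.mpr h] at this
      exact WithTop.coe_ne_top this.symm
    filter_upwards [h] with y hy using inv_ne_zero hy
  have hmap : (secQuot D).map (mulQuot f₀⁻¹) ≤ secQuot (D + E) := by
    rintro _ ⟨_, ⟨f, hf, rfl⟩, rfl⟩
    rw [mulQuot_mkQ]
    refine mkQ_mem_secQuot.mpr fun x => ⟨(hf₀ x).inv.mul (hf x).1, ?_⟩
    have h1 : ordAt (f₀⁻¹ * f) x = ordAt f₀⁻¹ x + ordAt f x :=
      meromorphicOrderAt_mul (hf₀ x).inv (hf x).1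
    have h2 : ordAt f₀⁻¹ x = ((-(E x) : ℤ) : WithTop ℤ) := by
      have : ordAt f₀⁻¹ x = -ordAt f₀ x := meromorphicOrderAt_inv
      rw [this, hE x]
      rfl
    rw [h1, h2, Finsupp.add_apply]
    refine le_trans ?_ (add_le_add_right (hf x).2 _)
    exact_mod_cast (by omega : -(D x + E x) ≤ -(E x) + -(D x))
  rw [h0_eq, h0_eq,
    (Submodule.equivMapOfInjective (mulQuot f₀⁻¹) (mulQuot_injective hne) (secQuot D)).finrank_eq]
  exact Submodule.finrank_mono hmap

open Classical in
theorem count_gap_add_count_nonGap (D : X →₀ ℤ) (p : X) (N : ℕ) :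
    Nat.count (IsGap D p) N + Nat.count (IsNonGap D p) N = N :=
  count_add_count_of_iff_not (q := IsNonGap D p) (r := IsGap D p) (fun _ => Iff.rfl) N

open Classical in
theorem nonGap_strictMonoOn (D : X →₀ ℤ) (p : X) (n : ℕ) :
    StrictMonoOn (nonGap D p) (Iio (Nat.count (IsNonGap D p) n)) := by
  intro i _ j hj hij
  refine Nat.nth_lt_nth' hij fun hf => lt_of_lt_of_le hj ?_
  rw [Nat.count_eq_card_filter_range]
  refine Finset.card_le_card fun b hb => ?_
  rw [Set.Finite.mem_toFinset]
  exact (Finset.mem_filter.mp hb).2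

open Classical in
theorem isNonGap_nonGap (D : X →₀ ℤ) (p : X) {n i : ℕ} (hi : i < Nat.count (IsNonGap D p) n) :
    IsNonGap D p (nonGap D p i) := by
  refine Nat.nth_mem i fun hf => lt_of_lt_of_le hi ?_
  rw [Nat.count_eq_card_filter_range]
  refine Finset.card_le_card fun b hb => ?_
  rw [Set.Finite.mem_toFinset]
  exact (Finset.mem_filter.mp hb).2

variable [IsManifold 𝓘(ℂ) ω X] [T2Space X] [CompactSpace X] [ConnectedSpace X]

open Classical in
/-- There are at least `g` gaps. -/
theorem exists_genus_le_count_gap {D : X →₀ ℤ} (hD : divDegree D = 0) (p : X) :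
    ∃ N, genus X ≤ Nat.count (IsGap D p) N := by
  -- Otherwise `finrank` takes its default value 0, the genus is 0 and nothing is claimed.
  by_cases hfd : FiniteDimensional ℂ (HolOneForm X)
  swap
  · exact ⟨0, by rw [genus, finrank_of_not_finite hfd]; exact Nat.zero_le _⟩
  by_cases hng : ∃ b, IsNonGap D p b
  swap
  · refine ⟨genus X, ?_⟩
    have h1 := count_gap_add_count_nonGap D p (genus X)
    have h2 : Nat.count (IsNonGap D p) (genus X) = 0 := by
      rw [Nat.count_eq_card_filter_range, Finset.card_eq_zero, Finset.filter_eq_empty_iff]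
      exact fun b _ hb => hng ⟨b, hb⟩
    omega
  obtain ⟨b, f₀, hf₀, hoff, hpole⟩ := hng
  have hnull : f₀ ∉ nullFun X := by
    intro h
    rw [ordAt_eq_top_iff.mpr (h p), WithTop.top_add] at hpole
    exact WithTop.coe_ne_top hpole.symm
  obtain ⟨E, hE⟩ := exists_divisor hf₀ hnull
  have hEdeg := divDegree_eq_zero hf₀ E hE
  obtain ⟨N₀, hN₀⟩ := exists_formSpace_single_eq_bot (X := X) p
  -- Chosen so that `F = D + N p + (f₀)` has coefficient `N - b = N₀` at `p`. Off `p` it is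
  -- effective because `f₀` is a holomorphic section there, so no non-zero form vanishes along `F`.
  set N := b + N₀ with hN
  set F : X →₀ ℤ := D + Finsupp.single p (N : ℤ) + E with hF
  have hEoff : ∀ x, x ≠ p → 0 ≤ E x + D x := by
    intro x hx
    have := hoff x hx
    rw [hE x] at this
    exact_mod_cast this
  have hEp : E p + D p = -(b : ℤ) := by
    rw [hE p] at hpole
    exact_mod_cast hpole
  have hFle : Finsupp.single p (N₀ : ℤ) ≤ F := by
    intro x
    rw [hF, Finsupp.add_apply, Finsupp.add_apply]
    by_cases hx : x = p
    · subst hx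
      rw [Finsupp.single_eq_same, Finsupp.single_eq_same, hN]
      push_cast
      omega
    · rw [Finsupp.single_eq_of_ne hx, Finsupp.single_eq_of_ne hx]
      have := hEoff x hx
      omega
  have hF0 : 0 ≤ F := le_trans (fun x => by
    rw [Finsupp.single_apply]; split_ifs <;> simp) hFle
  have hFdeg : divDegree F = N := by
    rw [hF, divDegree_add, divDegree_add, divDegree_single, hD, hEdeg]
    ring
  have : Nonempty X := ⟨p⟩
  obtain ⟨hfin, hRR⟩ := h0_add_genus_le N F hF0 hFdeg
  have hform : finrank ℂ (formSpace F) = 0 := by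
    have hbot : formSpace F = ⊥ := eq_bot_iff.mpr (hN₀ ▸ formSpace_anti hFle)
    rw [hbot, finrank_bot]
  have hle : h0 (D + Finsupp.single p (N : ℤ)) ≤ h0 F := h0_le_h0_add hf₀ _ E hE
  have hcount := (finrank_secQuot_eq_count hD p (N + 1)).2
  rw [show (((N + 1 : ℕ) : ℤ) - 1) = N by push_cast; ring, ← h0_eq] at hcount
  -- The non-gaps among `0, …, N` number `h⁰(D + N p) ≤ h⁰(F) ≤ N + 1 - g`.
  refine ⟨N + 1, ?_⟩
  have h1 := count_gap_add_count_nonGap D p (N + 1)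
  omega

/-- Excludes the default value 0 that `Nat.nth` takes beyond the end of a finite set, so `gap D p j`
is a true gap for `j < g`. -/
theorem lt_card_gaps {D : X →₀ ℤ} (hD : divDegree D = 0) (p : X) {j : ℕ} (hj : j < genus X)
    (hf : (Set.ofPred (IsGap D p)).Finite) : j < hf.toFinset.card := by
  classical
  obtain ⟨N, hN⟩ := exists_genus_le_count_gap hD p
  refine lt_of_lt_of_le (lt_of_lt_of_le hj hN) ?_
  rw [Nat.count_eq_card_filter_range]
  refine Finset.card_le_card fun b hb => ?_
  rw [Set.Finite.mem_toFinset]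
  exact (Finset.mem_filter.mp hb).2

theorem isGap_gap {D : X →₀ ℤ} (hD : divDegree D = 0) (p : X) {j : ℕ} (hj : j < genus X) :
    IsGap D p (gap D p j) :=
  Nat.nth_mem j fun hf => lt_card_gaps hD p hj hf

theorem gap_strictMonoOn {D : X →₀ ℤ} (hD : divDegree D = 0) (p : X) :
    StrictMonoOn (gap D p) (Iio (genus X)) := fun _ _ _ hj hij =>
  Nat.nth_lt_nth' hij fun hf => lt_card_gaps hD p hj hf

theorem le_gap {D : X →₀ ℤ} (hD : divDegree D = 0) (p : X) {j : ℕ} (hj : j < genus X) :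
    j ≤ gap D p j := by
  induction j with
  | zero => exact Nat.zero_le _
  | succ j ih =>
    have h1 := ih (by omega)
    have h2 := gap_strictMonoOn hD p (show j ∈ Iio (genus X) from (by omega : j < genus X)) hj
      (Nat.lt_succ_self j)
    omega

open Classical in
theorem le_gap_of_count_le {D : X →₀ ℤ} (hD : divDegree D = 0) (p : X) {j n : ℕ}
    (hj : j < genus X) (h : Nat.count (IsGap D p) n ≤ j) : n ≤ gap D p j := by
  by_contra hlt
  push Not at hlt
  have h1 : Nat.count (IsGap D p) (gap D p j) = j :=
    Nat.count_nth fun hf => lt_card_gaps hD p hj hf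
  have h2 := Nat.count_strict_mono (isGap_gap hD p hj) hlt
  omega

theorem isPartition_gapPartition {D : X →₀ ℤ} (hD : divDegree D = 0) (p : X) :
    IsPartition (genus X) (gapPartition D p) := by
  refine ⟨antitone_nat_of_succ_le fun i => ?_, fun i hi => if_neg (by omega)⟩
  rw [gapPartition, gapPartition]
  by_cases hi : i + 1 < genus X
  · rw [if_pos hi, if_pos (by omega)]
    have h := gap_strictMonoOn hD p (show genus X - 1 - (i + 1) < genus X by omega)
      (show genus X - 1 - i < genus X by omega) (by omega)
    -- Keeps the truncated subtraction in the definition of `λ` honest.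
    have h1 := le_gap hD p (show genus X - 1 - (i + 1) < genus X by omega)
    omega
  · rw [if_neg hi]
    exact Nat.zero_le _

end Gaps

end

end RiemannSchur

/-! ### The theorem, assembled from the gap count and the determinants. -/

open RiemannSchur in
theorem mainTheorem8 {X : Type*} [TopologicalSpace X] [T2Space X] [CompactSpace X]
    [ConnectedSpace X] [ChartedSpace ℂ X] [IsManifold 𝓘(ℂ) ω X]
    (p : X) (D : X →₀ ℤ) (hD : divDegree D = 0) :
    -- derivatives along the a-sequence, restricted to sums of `k` points
    (∀ k : ℕ, k < genus X → 0 < mult D p k →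
      ∃ σ : Equiv.Perm (Fin (genus X - k)), IsGapPerm D p k σ ∧
        ∀ (l : ℕ) (μ : ℕ → ℕ), IsPartition l μ → (∀ i, k ≤ i → μ i = gapPartition D p i) →
          ∀ x : Fin k → ℂ,
            MvPolynomial.eval (bracketSum x) (partialT (aSeq D p k) (schur l μ)) =
              ((Equiv.Perm.sign σ : ℤ) : ℂ) * MvPolynomial.eval (bracketSum x) (schur k μ)) ∧
    -- vanishing for reasons of weight
    (∀ (l : ℕ) (μ : ℕ → ℕ), IsPartition l μ →
      ∀ I : List ℕ, I ≠ [] → (∀ i ∈ I, 0 < i) → I.sum ≠ ∑ i ∈ Finset.range l, μ i →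
        MvPolynomial.eval (0 : ℕ → ℂ) (partialT I (schur l μ)) = 0) ∧
    -- vanishing of the derivatives of order less than `m_0`
    (∀ (l : ℕ) (μ : ℕ → ℕ), IsPartition l μ → (∀ i, gapPartition D p i ≤ μ i) →
      ∀ I : List ℕ, (∀ i ∈ I, 0 < i) → I.length < mult D p 0 →
        MvPolynomial.eval (0 : ℕ → ℂ) (partialT I (schur l μ)) = 0) ∧
    -- the non-vanishing derivative of order `m_0`
    (∃ σ : Equiv.Perm (Fin (genus X - 0)), IsGapPerm D p 0 σ ∧
      MvPolynomial.eval (0 : ℕ → ℂ)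
          (partialT (aSeq D p 0) (schur (genus X) (gapPartition D p))) =
        ((Equiv.Perm.sign σ : ℤ) : ℂ)) := by
  classical
  -- the combinatorial data for `k ≤ g`
  have key : ∀ k, k ≤ genus X →
      ∃ σ : Equiv.Perm (Fin (genus X - k)), IsGapPerm D p k σ ∧
        ∀ (l : ℕ) (μ : ℕ → ℕ), IsPartition l μ → (∀ i, k ≤ i → μ i = gapPartition D p i) →
          ∀ x : Fin k → ℂ,
            MvPolynomial.eval (bracketSum x) (partialT (aSeq D p k) (schur l μ)) =
              ((Equiv.Perm.sign σ : ℤ) : ℂ) * MvPolynomial.eval (bracketSum x) (schur k μ) := by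
    intro k hk
    have hm := mult_eq_count hD p hk
    -- Of the `g - k` integers below `g - k`, `m_k` are non-gaps; the gaps below `g - k` are thus
    -- the first `g - k - m_k` ones.
    have hadd := count_gap_add_count_nonGap D p (genus X - k)
    rw [← hm] at hadd
    have hnon : ∀ i < mult D p k, IsNonGap D p (nonGap D p i) ∧ nonGap D p i < genus X - k := by
      intro i hi
      rw [hm] at hi
      exact ⟨isNonGap_nonGap D p hi, Nat.nth_lt_of_lt_count hi⟩
    have hgaps : ∀ v, v < genus X - k → (∀ i, i < mult D p k → v ≠ nonGap D p i) →
        ∃ j, j + mult D p k < genus X - k ∧ gap D p j = v := by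
      intro v hv hne
      have hgap : IsGap D p v := by
        intro hv'
        refine hne (Nat.count (IsNonGap D p) v) ?_ (Nat.nth_count hv').symm
        rw [hm]
        exact Nat.count_strict_mono hv' hv
      refine ⟨Nat.count (IsGap D p) v, ?_, Nat.nth_count hgap⟩
      have := Nat.count_strict_mono hgap hv
      omega
    obtain ⟨σ, hσ, hmain⟩ := exists_perm_eval_partialT_schur (k := k) (n := genus X - k)
      (gap D p) (nonGap D p) (mult D p k) (by omega)
      ((gap_strictMonoOn hD p).mono fun j (hj : j < genus X - k) =>
        show j < genus X by omega)
      (nonGap_strictMonoOn D p (genus X - k) |>.mono fun i (hi : i < mult D p k) => by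
        rw [hm] at hi; exact hi)
      (fun j hj => Nat.nth_lt_of_lt_count (by omega))
      (fun j hj hjm => le_gap_of_count_le hD p (by omega) (by omega))
      (fun i hi => (hnon i hi).2)
      (fun i hi j hj h => isGap_gap hD p (show j < genus X by omega) (h ▸ (hnon i hi).1))
      hgaps
    refine ⟨σ, hσ, fun l μ hμ hμg x => ?_⟩
    have h := hmain l μ hμ (fun i hi => ?_) (fun i hi => ?_) x
    · rw [← h, aSeq]
    · rw [hμg (k + i) (by omega), gapPartition, if_pos (by omega)]
      rw [show genus X - 1 - (k + i) = genus X - k - 1 - i by omega]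
    · rw [hμg i (by omega), gapPartition, if_neg (by omega)]
  have hpart : IsPartition (genus X) (gapPartition D p) := isPartition_gapPartition hD p
  refine ⟨fun k hk _ => key k hk.le, fun l μ _ I _ hI hsum =>
    eval_zero_partialT_schur_of_sum_ne hI hsum, fun l μ hμ hle I hI hlen => ?_, ?_⟩
  · refine eval_zero_partialT_schur_of_length_lt hI hlen hμ.2 fun i hi => ?_
    refine lt_of_lt_of_le ?_ (hle i)
    have hm := mult_eq_count hD p (Nat.zero_le (genus X))
    have hadd := count_gap_add_count_nonGap D p (genus X - 0)
    rw [← hm] at hadd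
    have hlt : i < genus X := by omega
    -- Only `g - m_0` gaps lie below `g`, so for `i < m_0` the gap of index `g - 1 - i` is at least
    -- `g`, and `λ_{i+1} ≥ i + 1`.
    have hge := le_gap_of_count_le hD p (j := genus X - 1 - i) (n := genus X - 0) (by omega)
      (by omega)
    rw [gapPartition, if_pos hlt]
    omega
  · obtain ⟨σ, hσ, h⟩ := key 0 (Nat.zero_le _)
    refine ⟨σ, hσ, ?_⟩
    -- The sum of no points is the origin, and the Schur function with no rows is 1.
    have h1 := h (genus X) (gapPartition D p) hpart (fun _ _ => rfl) Fin.elim0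
    rw [bracketSum_elim0] at h1
    rw [h1]
    simp [schur]
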